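/- Fix $n\ge 0$ and a Floquet code on $n$ qubits: a non-empty finite schedule $O_1,\dots,O_k$, repeated forever, in which each operation is a measurement of a Pauli string or a Clifford unitary on the $n$ qubits. Fix $t\ge 0$ and an outcome $\pm1$ for each measurement. Let $C_t$ be the linear map on $n$ qubits obtained by composing the first $t$ operations, where a measurement of the Pauli string $P$ with outcome $\pm1$ contributes the projector $\frac12(1\pm P)$, and assume that $C_t\neq 0$. The instantaneous stabiliser group $S_t$ is the group of all (signed) Pauli operators $s$ with $s\,C_t=C_t$. Let $N(S_t)$ be its normaliser in the Pauli group $\{i^kP_1\otimes\dots\otimes P_n\}$. Let $\mathcal D$ be any Clifford ZX diagram with $n$ inputs and $n$ outputs (a finite graph of Z spiders, X spiders with phases in $\frac{\pi}{2}\mathbb Z/2\pi\mathbb Z$, two-legged Hadamard nodes, and one-legged boundary nodes; parallel edges and self-loops are allowed) that represents $C_t$ up to a non-zero scalar. A Pauli web on $\mathcal D$ is a set $w$ of pairs of an edge and a colour in $\{Z,X\}$ (we say that the edge is highlighted in that colour) such that - at a spider with phase in $\{0,\pi\}$, an even number of legs is highlighted in the spider's own colour, and either all or none of its legs are highlighted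 in the opposite colour; - at a spider with phase $\pm\frac{\pi}{2}$, either an even number of legs is highlighted in its own colour and none in the opposite colour, or an odd number of legs is highlighted in its own colour and all in the opposite colour; - at a Hadamard node, one leg is highlighted in $Z$ if and only if the other leg is highlighted in $X$, and vice versa. Let $P$ be the set of all Pauli webs, $S$ the set of those that highlight no input edge (stabilising webs), $S_c$ the set of those that highlight no output edge (co-stabilising webs), and $D=S\cap S_c$ the set of those that highlight no boundary edge (detecting regions). Let $\mathrm{out}(w)$ be the Pauli string read off the output edges, with $Y$ where both colours are highlighted. Webs are multiplied by symmetric difference $\Delta$, and for sets of webs $G,N$ with $g\,\Delta\, n\in G$ for all $g\in G$, $n\in N$ we write $G/N=\{\{g\,\Delta\, n: n\in N\}: g\in G\}$. Let $S\,\Delta\, S_c=\{s\,\Delta\, c: s\in S,\ c\in S_c\}$. Then: 1. There is a bijection $b\colon S/D\to S_t$ such that $b(A)=\pm\,\mathrm{out}(w)$ for every class $A\in S/D$ and every $w\in A$. 2. For every Pauli web $w$, $\mathrm{out}(w)\in N(S_t)$, and there is a bijection from $P/(S\,\Delta\, S_c)$ to $N(S_t)/S_t$, with the global phases $\{1,i,-1,-i\}$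 divided out as well, that sends each class $A$ to the class of $\mathrm{out}(w)$ for every $w\in A$. -/

import Mathlib

/-! Clifford ZX diagrams, Pauli webs, Floquet codes and their instantaneous stabiliser groups.
The computational basis of `n` qubits is indexed by `Fin n → Fin 2`. -/

open scoped symmDiff

noncomputable section

namespace FloquetWebs

/-! ### Pauli operators -/

/-- The four one-qubit Pauli letters. -/
inductive Pauli where
  | I | X | Y | Z

/-- The matrix of a one-qubit Pauli. -/
def Pauli.toMatrix : Pauli → Matrix (Fin 2) (Fin 2) ℂ
  | .I => 1
  | .X => !![0, 1; 1, 0]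
  | .Y => !![0, -Complex.I; Complex.I, 0]
  | .Z => !![1, 0; 0, -1]

/-- An (unsigned) Pauli string on `n` qubits. -/
abbrev PauliString (n : ℕ) := Fin n → Pauli

/-- The operator `P₁ ⊗ ⋯ ⊗ Pₙ` of a Pauli string. -/
def pauliMatrix {n : ℕ} (P : PauliString n) : Matrix (Fin n → Fin 2) (Fin n → Fin 2) ℂ :=
  fun y x => ∏ i, (P i).toMatrix (y i) (x i)

/-- The unitary operators on `n` qubits. -/
abbrev QubitUnitary (n : ℕ) := Matrix.unitaryGroup (Fin n → Fin 2) ℂ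

theorem pauli_mul (a b : Pauli) :
    ∃ (k : ℕ) (c : Pauli), a.toMatrix * b.toMatrix = Complex.I ^ k • c.toMatrix := by
  cases a <;> cases b
  · exact ⟨0, .I, by simp [Pauli.toMatrix]⟩
  · exact ⟨0, .X, by simp [Pauli.toMatrix]⟩
  · exact ⟨0, .Y, by simp [Pauli.toMatrix]⟩
  · exact ⟨0, .Z, by simp [Pauli.toMatrix]⟩
  · exact ⟨0, .X, by simp [Pauli.toMatrix]⟩
  · exact ⟨0, .I, by simp [Pauli.toMatrix, Matrix.one_fin_two]⟩
  · exact ⟨1, .Z, by simp [Pauli.toMatrix]⟩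
  · exact ⟨3, .Y, by simp [Pauli.toMatrix, Complex.I_pow_three]⟩
  · exact ⟨0, .Y, by simp [Pauli.toMatrix]⟩
  · exact ⟨3, .Z, by simp [Pauli.toMatrix, Complex.I_pow_three]⟩
  · exact ⟨0, .I, by simp [Pauli.toMatrix, Matrix.one_fin_two]⟩
  · exact ⟨1, .X, by simp [Pauli.toMatrix]⟩
  · exact ⟨0, .Z, by simp [Pauli.toMatrix]⟩
  · exact ⟨1, .Y, by simp [Pauli.toMatrix]⟩
  · exact ⟨3, .X, by simp [Pauli.toMatrix, Complex.I_pow_three]⟩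
  · exact ⟨0, .I, by simp [Pauli.toMatrix, Matrix.one_fin_two]⟩

theorem pauli_sq (a : Pauli) : a.toMatrix * a.toMatrix = 1 := by
  cases a <;> simp [Pauli.toMatrix, Matrix.one_fin_two]

theorem pauli_star (a : Pauli) (i j : Fin 2) : star (a.toMatrix j i) = a.toMatrix i j := by
  cases a <;> fin_cases i <;> fin_cases j <;> simp [Pauli.toMatrix]

theorem pauliMatrix_mul_apply {n : ℕ} (P Q : PauliString n) (y x : Fin n → Fin 2) :
    (pauliMatrix P * pauliMatrix Q) y x =
      ∏ i, ((P i).toMatrix * (Q i).toMatrix) (y i) (x i) := by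
  simp only [Matrix.mul_apply, pauliMatrix, ← Finset.prod_mul_distrib]
  rw [Finset.prod_univ_sum]
  simp

theorem pauliMatrix_mul {n : ℕ} (P Q : PauliString n) :
    ∃ (k : ℕ) (R : PauliString n),
      pauliMatrix P * pauliMatrix Q = Complex.I ^ k • pauliMatrix R := by
  choose k R h using fun i => pauli_mul (P i) (Q i)
  refine ⟨∑ i, k i, R, ?_⟩
  ext y x
  rw [pauliMatrix_mul_apply]
  simp [h, pauliMatrix, Finset.prod_mul_distrib, Finset.prod_pow_eq_pow_sum]

theorem pauliMatrix_sq {n : ℕ} (P : PauliString n) : pauliMatrix P * pauliMatrix P = 1 := by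
  ext y x
  rw [pauliMatrix_mul_apply]
  simp only [pauli_sq, Matrix.one_apply]
  by_cases h : y = x
  · simp [h]
  · rw [if_neg h]
    obtain ⟨i, hi⟩ := Function.ne_iff.mp h
    exact Finset.prod_eq_zero (Finset.mem_univ i) (if_neg hi)

theorem pauliMatrix_star {n : ℕ} (P : PauliString n) : star (pauliMatrix P) = pauliMatrix P := by
  ext y x
  simp [pauliMatrix, Matrix.star_apply, ← pauli_star (P _) (y _) (x _)]

theorem pauliMatrix_one {n : ℕ} : pauliMatrix (fun _ : Fin n => Pauli.I) = 1 := by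
  rw [← pauliMatrix_sq (fun _ : Fin n => Pauli.I)]
  ext y x
  rw [pauliMatrix_mul_apply]
  simp [pauliMatrix, Pauli.toMatrix]

/-- A Pauli string as a unitary operator. -/
def pauliUnitary {n : ℕ} (P : PauliString n) : QubitUnitary n :=
  ⟨pauliMatrix P, by rw [Matrix.mem_unitaryGroup_iff, pauliMatrix_star, pauliMatrix_sq]⟩

/-- The `n`-qubit Pauli group `{iᵏ P₁ ⊗ ⋯ ⊗ Pₙ}`. -/
def pauliGroup (n : ℕ) : Subgroup (QubitUnitary n) where
  carrier := {U | ∃ (k : ℕ) (P : PauliString n),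
    (U : Matrix (Fin n → Fin 2) (Fin n → Fin 2) ℂ) = Complex.I ^ k • pauliMatrix P}
  one_mem' := ⟨0, fun _ => .I, by simp [pauliMatrix_one]⟩
  mul_mem' := by
    rintro U V ⟨k, P, hU⟩ ⟨l, Q, hV⟩
    obtain ⟨m, R, h⟩ := pauliMatrix_mul P Q
    refine ⟨k + l + m, R, ?_⟩
    simp only [Submonoid.coe_mul, hU, hV, Matrix.smul_mul, Matrix.mul_smul, h, smul_smul]
    ring_nf
  inv_mem' := by
    rintro U ⟨k, P, hU⟩
    refine ⟨3 * k, P, ?_⟩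
    rw [Matrix.UnitaryGroup.inv_val, hU, star_smul, pauliMatrix_star, pow_mul,
      Complex.I_pow_three]
    simp

/-- The global phases `{1, i, -1, -i}`. -/
def phaseGroup (n : ℕ) : Subgroup (QubitUnitary n) where
  carrier := {U | ∃ k : ℕ,
    (U : Matrix (Fin n → Fin 2) (Fin n → Fin 2) ℂ) = Complex.I ^ k • 1}
  one_mem' := ⟨0, by simp⟩
  mul_mem' := by
    rintro U V ⟨k, hU⟩ ⟨l, hV⟩
    refine ⟨k + l, ?_⟩
    simp only [Submonoid.coe_mul, hU, hV, Matrix.smul_mul, Matrix.mul_smul, smul_smul, one_mul]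
    ring_nf
  inv_mem' := by
    rintro U ⟨k, hU⟩
    refine ⟨3 * k, ?_⟩
    rw [Matrix.UnitaryGroup.inv_val, hU, star_smul, star_one, pow_mul, Complex.I_pow_three]
    simp

/-- The Clifford group: the unitaries that normalise the Pauli group. -/
def cliffordGroup (n : ℕ) : Subgroup (QubitUnitary n) :=
  Subgroup.normalizer (pauliGroup n)

/-- The (signed) Pauli operators `s` that stabilise the map `M`, i.e. `s ∘ M = M`. -/
def stabiliserGroup {n : ℕ} (M : Matrix (Fin n → Fin 2) (Fin n → Fin 2) ℂ) :
    Subgroup (QubitUnitary n) where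
  carrier := {s | s ∈ pauliGroup n ∧
    (s : Matrix (Fin n → Fin 2) (Fin n → Fin 2) ℂ) * M = M}
  one_mem' := ⟨one_mem _, by simp⟩
  mul_mem' := by
    rintro U V ⟨hU, hU'⟩ ⟨hV, hV'⟩
    refine ⟨mul_mem hU hV, ?_⟩
    rw [Submonoid.coe_mul, Matrix.mul_assoc, hV', hU']
  inv_mem' := by
    rintro U ⟨hU, hU'⟩
    refine ⟨inv_mem hU, ?_⟩
    conv_lhs => rw [← hU']
    rw [← Matrix.mul_assoc, ← Submonoid.coe_mul, inv_mul_cancel]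
    simp

/-- `N(S)`: the normaliser of `S` in the Pauli group. -/
def pauliNormalizer {n : ℕ} (S : Subgroup (QubitUnitary n)) : Subgroup (QubitUnitary n) :=
  Subgroup.normalizer S ⊓ pauliGroup n

/-- `N(S) / S` for unsigned Paulis, i.e. with global phases divided out as well. -/
abbrev Logicals {n : ℕ} (S : Subgroup (QubitUnitary n)) :=
  pauliNormalizer S ⧸ (S ⊔ phaseGroup n).subgroupOf (pauliNormalizer S)

/-! ### Floquet codes -/

/-- One operation of a measurement schedule on `n` qubits. -/
inductive Operation (n : ℕ) where
  | measurement (P : PauliString n)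
  | unitary (U : QubitUnitary n) (hU : U ∈ cliffordGroup n)

/-- The linear map of an operation. A measurement of `P` is post-selected on an outcome
(`false` for `+1`, `true` for `-1`), so that it is the projector `(1 ± P) / 2`. -/
def Operation.toMatrix {n : ℕ} (O : Operation n) (outcome : Bool) :
    Matrix (Fin n → Fin 2) (Fin n → Fin 2) ℂ :=
  match O with
  | .measurement P => (1 / 2 : ℂ) • (1 + (if outcome then (-1 : ℂ) else 1) • pauliMatrix P)
  | .unitary U _ => U

/-- A Floquet code on `n` qubits: a (non-empty) measurement schedule, repeated forever. -/
structure FloquetCode (n : ℕ) where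
  schedule : List (Operation n)
  schedule_ne_nil : schedule ≠ []

/-- The operation performed in the time step with number `j` (counted from `0`). -/
def FloquetCode.op {n : ℕ} (F : FloquetCode n) (j : ℕ) : Operation n :=
  F.schedule[j % F.schedule.length]'
    (Nat.mod_lt _ (List.length_pos_iff.mpr F.schedule_ne_nil))

/-- The linear map of the first `t` time steps, when the measurement in time step `j`
(if there is one) has the outcome `o j`. -/
def FloquetCode.circuit {n : ℕ} (F : FloquetCode n) (o : ℕ → Bool) :
    ℕ → Matrix (Fin n → Fin 2) (Fin n → Fin 2) ℂ
  | 0 => 1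
  | t + 1 => (F.op t).toMatrix (o t) * F.circuit o t

/-- The instantaneous stabiliser group after `t` time steps: the Pauli operators
stabilised by the circuit of the first `t` operations. -/
def FloquetCode.instStabGroup {n : ℕ} (F : FloquetCode n) (o : ℕ → Bool) (t : ℕ) :
    Subgroup (QubitUnitary n) :=
  stabiliserGroup (F.circuit o t)

/-! ### ZX diagrams -/

/-- Vertex types: Z spider, X spider, Hadamard node, boundary node. -/
inductive NodeType where
  | Z | X | H | B

/-- A Clifford ZX diagram with vertices `V`, edges `E`, `m` inputs and `n` outputs. The two legs
(half-edges) of the edge `e` are `(e, false)` and `(e, true)`, and `ends` sends a leg to the vertex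
that it is attached to; the order of the two legs of an edge is irrelevant. Parallel edges and
self-loops are allowed. The phase `k : ZMod 4` of a spider stands for `k * π / 2`. -/
structure ZXDiagram (V E : Type*) [Fintype V] [Fintype E] (m n : ℕ) where
  ends : E × Bool → V
  type : V → NodeType
  phase : V → ZMod 4
  /-- The boundary nodes are the inputs and the outputs. -/
  boundary : Fin m ⊕ Fin n ≃ {v : V // type v = NodeType.B}
  hadamard_degree : ∀ v, type v = NodeType.H → Nat.card {l : E × Bool // ends l = v} = 2
  boundary_degree : ∀ v, type v = NodeType.B → Nat.card {l : E × Bool // ends l = v} = 1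

namespace ZXDiagram

variable {V E : Type*} [Fintype V] [Fintype E] {m n : ℕ} (D : ZXDiagram V E m n)

/-- The `i`-th input node. -/
def input (i : Fin m) : V := (D.boundary (Sum.inl i)).1

/-- The `j`-th output node. -/
def output (j : Fin n) : V := (D.boundary (Sum.inr j)).1

open Classical in
/-- The legs of a vertex. A self-loop contributes two legs. -/
def legs (v : V) : Finset (E × Bool) := {l | D.ends l = v}

open Classical in
/-- The tensor of the vertex `v`, evaluated at the basis labels `σ` of the edges:
`|0…0⟩ + e^{ikπ/2} |1…1⟩` for a Z spider, `|+…+⟩ + e^{ikπ/2} |-…-⟩` for an X spider, and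
`2^{-1/2} (-1)^{ab}` for a Hadamard node with legs labelled `a` and `b`. -/
def tensor (σ : E → Fin 2) (v : V) : ℂ :=
  match D.type v with
  | .Z => (if ∀ l ∈ D.legs v, σ l.1 = 0 then 1 else 0) +
      Complex.I ^ (D.phase v).val * (if ∀ l ∈ D.legs v, σ l.1 = 1 then 1 else 0)
  | .X => (∏ _l ∈ D.legs v, (1 / (√2 : ℂ))) +
      Complex.I ^ (D.phase v).val * ∏ l ∈ D.legs v, ((-1) ^ (σ l.1).val / (√2 : ℂ))
  | .H => (1 / (√2 : ℂ)) * (if ∀ l ∈ D.legs v, σ l.1 = 1 then -1 else 1)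
  | .B => 1

open Classical in
/-- The interpretation of a diagram as a linear map from `m` to `n` qubits: contract the tensors
of the vertices along the edges. -/
def interp : Matrix (Fin n → Fin 2) (Fin m → Fin 2) ℂ := fun y x =>
  ∑ σ : E → Fin 2,
    if (∀ i, ∀ l ∈ D.legs (D.input i), σ l.1 = x i) ∧
        (∀ j, ∀ l ∈ D.legs (D.output j), σ l.1 = y j)
    then ∏ v, D.tensor σ v else 0

/-- The diagram represents the linear map `M`, up to a non-zero scalar. -/
def Represents (M : Matrix (Fin n → Fin 2) (Fin m → Fin 2) ℂ) : Prop :=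
  ∃ c : ℂ, c ≠ 0 ∧ D.interp = c • M

end ZXDiagram

/-! ### Pauli webs -/

/-- The two colours: green (`Z`) and red (`X`). -/
inductive Colour where
  | Z | X

/-- The Pauli letter of a (possibly) highlighted edge. -/
def pauliOfColours (z x : Prop) [Decidable z] [Decidable x] : Pauli :=
  if z then (if x then .Y else .Z) else (if x then .X else .I)

/-- The quotient equivalence classes `G / N = {g ∆ N : g ∈ G}`, where `g ∆ N = {g ∆ n : n ∈ N}`. -/
def quotientClasses {α : Type*} (G N : Set (Set α)) (_h : ∀ g ∈ G, ∀ n ∈ N, g ∆ n ∈ G) :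
    Set (Set (Set α)) :=
  {A | ∃ g ∈ G, A = {w | ∃ n ∈ N, w = g ∆ n}}

namespace ZXDiagram

variable {V E : Type*} [Fintype V] [Fintype E] {m n : ℕ} (D : ZXDiagram V E m n)

open Classical in
/-- The legs of `v` that lie on an edge highlighted in the colour `c`. -/
def highlighted (w : Set (E × Colour)) (v : V) (c : Colour) : Finset (E × Bool) :=
  {l ∈ D.legs v | (l.1, c) ∈ w}

/-- The condition at a spider `v` of colour `own`, where `opp` is the opposite colour. -/
def SpiderRule (w : Set (E × Colour)) (v : V) (own opp : Colour) : Prop :=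
  (D.phase v = 0 ∨ D.phase v = 2 →
    Even (D.highlighted w v own).card ∧
      (D.highlighted w v opp = D.legs v ∨ D.highlighted w v opp = ∅)) ∧
  (D.phase v = 1 ∨ D.phase v = 3 →
    (Even (D.highlighted w v own).card ∧ D.highlighted w v opp = ∅) ∨
      (Odd (D.highlighted w v own).card ∧ D.highlighted w v opp = D.legs v))

/-- The condition at a Hadamard node: the colours are exchanged between its two legs. -/
def HadamardRule (w : Set (E × Colour)) (v : V) : Prop :=
  ∀ l ∈ D.legs v, ∀ l' ∈ D.legs v, l ≠ l' → ((l.1, Colour.Z) ∈ w ↔ (l'.1, Colour.X) ∈ w)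

/-- A Pauli web: a set of pairs of an edge and a colour that obeys the rule of every vertex. -/
def IsPauliWeb (w : Set (E × Colour)) : Prop :=
  ∀ v, match D.type v with
    | .Z => D.SpiderRule w v .Z .X
    | .X => D.SpiderRule w v .X .Z
    | .H => D.HadamardRule w v
    | .B => True

/-- The web highlights no edge attached to `v`. -/
def Avoids (w : Set (E × Colour)) (v : V) : Prop := ∀ c, D.highlighted w v c = ∅

/-- All Pauli webs. -/
def pauliWebs : Set (Set (E × Colour)) := {w | D.IsPauliWeb w}

/-- Pauli webs that highlight no input edges. -/
def stabilisingWebs : Set (Set (E × Colour)) :=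
  {w | D.IsPauliWeb w ∧ ∀ i, D.Avoids w (D.input i)}

/-- Pauli webs that highlight no output edges. -/
def coStabilisingWebs : Set (Set (E × Colour)) :=
  {w | D.IsPauliWeb w ∧ ∀ j, D.Avoids w (D.output j)}

/-- Pauli webs that highlight no boundary edges. -/
def detectingRegions : Set (Set (E × Colour)) :=
  {w | D.IsPauliWeb w ∧ (∀ i, D.Avoids w (D.input i)) ∧ ∀ j, D.Avoids w (D.output j)}

/-- The combinations of stabilising and co-stabilising webs. -/
def trivialWebs : Set (Set (E × Colour)) :=
  {w | ∃ s ∈ D.stabilisingWebs, ∃ c ∈ D.coStabilisingWebs, w = s ∆ c}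

open Classical in
/-- The Pauli string given by the highlighted output edges. -/
def out (w : Set (E × Colour)) : PauliString n := fun j =>
  pauliOfColours (D.highlighted w (D.output j) .Z).Nonempty
    (D.highlighted w (D.output j) .X).Nonempty

/-! The product of two Pauli webs is a Pauli web. -/

open Classical in
theorem highlighted_symmDiff (w w' : Set (E × Colour)) (v : V) (c : Colour) :
    D.highlighted (w ∆ w') v c = D.highlighted w v c ∆ D.highlighted w' v c := by
  ext l
  simp only [highlighted, Finset.mem_filter, Finset.mem_symmDiff, Set.mem_symmDiff]
  tauto

theorem even_card_symmDiff {α : Type*} [DecidableEq α] (s t : Finset α) :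
    Even (s ∆ t).card ↔ (Even s.card ↔ Even t.card) := by
  have h1 : (s ∆ t).card = (s \ t).card + (t \ s).card := by
    rw [symmDiff_def, Finset.sup_eq_union, Finset.card_union_of_disjoint disjoint_sdiff_sdiff]
  have h2 := Finset.card_sdiff_add_card_inter s t
  have h3 := Finset.card_sdiff_add_card_inter t s
  rw [Finset.inter_comm] at h3
  rw [h1, ← h2, ← h3]
  simp only [Nat.even_add]
  tauto

theorem SpiderRule.symmDiff {w w' : Set (E × Colour)} {v : V} {a b : Colour}
    (h : D.SpiderRule w v a b) (h' : D.SpiderRule w' v a b) : D.SpiderRule (w ∆ w') v a b := by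
  classical
  refine ⟨fun hp => ?_, fun hp => ?_⟩
  · obtain ⟨h1, h2⟩ := h.1 hp
    obtain ⟨h1', h2'⟩ := h'.1 hp
    rw [D.highlighted_symmDiff, D.highlighted_symmDiff, even_card_symmDiff]
    refine ⟨by tauto, ?_⟩
    rcases h2 with h2 | h2 <;> rcases h2' with h2' | h2' <;> rw [h2, h2'] <;>
      simp [← Finset.bot_eq_empty]
  · rw [D.highlighted_symmDiff, D.highlighted_symmDiff, ← Nat.not_even_iff_odd,
      even_card_symmDiff]
    rcases h.2 hp with ⟨h1, h2⟩ | ⟨h1, h2⟩ <;> rcases h'.2 hp with ⟨h1', h2'⟩ | ⟨h1', h2'⟩ <;>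
      rw [h2, h2'] <;> (try simp only [← Nat.not_even_iff_odd] at h1 h1') <;>
      simp [← Finset.bot_eq_empty, h1, h1']

theorem IsPauliWeb.symmDiff {w w' : Set (E × Colour)} (h : D.IsPauliWeb w)
    (h' : D.IsPauliWeb w') : D.IsPauliWeb (w ∆ w') := by
  intro v
  have hv := h v
  have hv' := h' v
  revert hv hv'
  cases D.type v
  · exact fun hv hv' => SpiderRule.symmDiff D hv hv'
  · exact fun hv hv' => SpiderRule.symmDiff D hv hv'
  · intro hv hv' l hl l' hl' hne
    have e := hv l hl l' hl' hne
    have e' := hv' l hl l' hl' hne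
    simp only [Set.mem_symmDiff]
    tauto
  · exact fun _ _ => trivial

theorem Avoids.symmDiff {w w' : Set (E × Colour)} {v : V} (h : D.Avoids w v)
    (h' : D.Avoids w' v) : D.Avoids (w ∆ w') v := by
  classical
  intro c
  rw [D.highlighted_symmDiff, h c, h' c]
  simp [← Finset.bot_eq_empty]

theorem stabilisingWebs_symmDiff :
    ∀ g ∈ D.stabilisingWebs, ∀ d ∈ D.detectingRegions, g ∆ d ∈ D.stabilisingWebs :=
  fun _ hg _ hd => ⟨IsPauliWeb.symmDiff D hg.1 hd.1,
    fun i => Avoids.symmDiff D (hg.2 i) (hd.2.1 i)⟩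

theorem pauliWebs_symmDiff :
    ∀ g ∈ D.pauliWebs, ∀ d ∈ D.trivialWebs, g ∆ d ∈ D.pauliWebs := by
  rintro g hg _ ⟨s, hs, c, hc, rfl⟩
  exact IsPauliWeb.symmDiff D hg (IsPauliWeb.symmDiff D hs.1 hc.1)

end ZXDiagram

end FloquetWebs

end

open FloquetWebs

/-!
Let `M` be a linear map that the diagram represents up to a non-zero scalar. Flipping the labels of
the edges according to a Pauli web multiplies each spider and Hadamard tensor by a scalar and by the
signs of the web on its legs. The signs on the two legs of an edge cancel, so that only boundary
signs remain: `P_out * M` is a multiple of `M * P_in`, where `P_in` and `P_out` are the Pauli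
strings of the web on the inputs and the outputs. Hence the output of a stabilising web stabilises
`M` up to a sign, and the output of any web commutes with the stabilisers of `M`.

The converses are linear algebra over `ZMod 2`. Label the legs of all vertices independently by
Pauli letters. The webs are the intersection of two spaces of labels: those that agree on the two
legs of each edge, and those that obey the rule of each vertex. For the symplectic form, the
orthogonal of each of these spaces is contained in the space itself, except that boundary nodes
that are free and boundary nodes where the label has to vanish are exchanged. As the orthogonal of
an intersection is the sum of the orthogonals, a Pauli string that commutes with the outputs of all
webs that avoid a set `I` of inputs is the output of a web that avoids all inputs outside `I`. The
stabilisers of `M` are the case where `I` is empty, their normaliser the case of all inputs.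
-/

noncomputable section

namespace FloquetWebs

/-! ### Pauli strings and the symplectic form -/

/-- The other colour. -/
def Colour.opp : Colour → Colour
  | .Z => .X
  | .X => .Z

@[simp]
theorem Colour.opp_opp (c : Colour) : c.opp.opp = c := by
  cases c <;> rfl

instance : DecidableEq Colour := Classical.decEq _

instance : Fintype Colour := ⟨{.Z, .X}, fun c => by cases c <;> simp⟩

theorem eq_zero_or_eq_one (a : ZMod 2) : a = 0 ∨ a = 1 := by
  fin_cases a
  exacts [.inl rfl, .inr rfl]

theorem sum_colour {M : Type*} [AddCommMonoid M] (f : Colour → M) (c : Colour) :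
    ∑ c', f c' = f c + f c.opp := by
  have hsum : ∑ c', f c' = f .Z + f .X := Finset.sum_pair (by simp)
  cases c
  · exact hsum
  · exact hsum.trans (add_comm _ _)

namespace Pauli

instance : One Pauli := ⟨.I⟩

/-- The product of Pauli letters up to a phase. -/
protected def mul : Pauli → Pauli → Pauli
  | .I, a | a, .I => a
  | .X, .X | .Y, .Y | .Z, .Z => .I
  | .X, .Y | .Y, .X => .Z
  | .Y, .Z | .Z, .Y => .X
  | .Z, .X | .X, .Z => .Y

instance : Mul Pauli := ⟨Pauli.mul⟩

/-- The Pauli letters modulo phases form Klein's four-group. -/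
instance : CommGroup Pauli where
  mul_assoc a b c := by cases a <;> cases b <;> cases c <;> rfl
  one_mul _ := rfl
  mul_one a := by cases a <;> rfl
  inv a := a
  inv_mul_cancel a := by cases a <;> rfl
  mul_comm a b := by cases a <;> cases b <;> rfl

theorem toMatrix_mul (a b : Pauli) :
    ∃ k : ℕ, a.toMatrix * b.toMatrix = Complex.I ^ k • (a * b).toMatrix := by
  change ∃ k : ℕ, a.toMatrix * b.toMatrix = Complex.I ^ k • (Pauli.mul a b).toMatrix
  cases a <;> cases b
  all_goals
    first
    | use 0; simp [Pauli.mul, toMatrix, Matrix.one_fin_two]; done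
    | use 1; simp [Pauli.mul, toMatrix]; done
    | use 3; simp [Pauli.mul, toMatrix, Complex.I_pow_three]

/-- The coordinates of a Pauli letter in the colours `Z` and `X`; the letter `Y` has both. -/
def bit : Pauli → Colour → ZMod 2
  | .I, _ => 0
  | .X, .X => 1
  | .X, .Z => 0
  | .Y, _ => 1
  | .Z, .X => 0
  | .Z, .Z => 1

@[simp]
theorem bit_one (c : Colour) : bit 1 c = 0 := rfl

theorem bit_mul (a b : Pauli) (c : Colour) : (a * b).bit c = a.bit c + b.bit c := by
  cases a <;> cases b <;> cases c <;> rfl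

theorem bit_pauliOfColours (p : Colour → Prop) [DecidablePred p] (c : Colour) :
    (pauliOfColours (p .Z) (p .X)).bit c = if p c then 1 else 0 := by
  by_cases hZ : p .Z <;> by_cases hX : p .X <;> cases c <;> simp [pauliOfColours, bit, hZ, hX]

theorem bit_injective : Function.Injective bit := by
  intro a b h
  have hZ := congrFun h .Z
  have hX := congrFun h .X
  cases a <;> cases b <;> simp_all [bit]

end Pauli

section PauliBits

variable {ι : Type*}

/-- The coordinate vector over `ZMod 2` of a family of Pauli letters. -/
def pauliBits (P : ι → Pauli) : ι × Colour → ZMod 2 := fun p => (P p.1).bit p.2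

@[simp]
theorem pauliBits_apply (P : ι → Pauli) (i : ι) (c : Colour) : pauliBits P (i, c) = (P i).bit c :=
  rfl

theorem pauliBits_mul (P Q : ι → Pauli) : pauliBits (P * Q) = pauliBits P + pauliBits Q :=
  funext fun _ => Pauli.bit_mul _ _ _

theorem pauliBits_injective : Function.Injective (pauliBits (ι := ι)) := fun _ _ h =>
  funext fun i => Pauli.bit_injective (funext fun c => congrFun h (i, c))

theorem pauliBits_surjective : Function.Surjective (pauliBits (ι := ι)) := fun b =>
  ⟨fun i => pauliOfColours (b (i, .Z) = 1) (b (i, .X) = 1), funext fun ⟨i, c⟩ => by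
    rw [pauliBits_apply, Pauli.bit_pauliOfColours fun c => b (i, c) = 1]
    obtain h | h := eq_zero_or_eq_one (b (i, c)) <;> simp [h]⟩

variable [Fintype ι]

variable (ι) in
/-- The symplectic form, which pairs the two colours. It detects whether two Pauli strings
commute. -/
def symplecticForm : LinearMap.BilinForm (ZMod 2) (ι × Colour → ZMod 2) :=
  LinearMap.mk₂ (ZMod 2) (fun a b => ∑ p, a p * b (p.1, p.2.opp))
    (fun _ _ _ => by simp only [Pi.add_apply, add_mul, Finset.sum_add_distrib])
    (fun _ _ _ => by simp only [Pi.smul_apply, smul_eq_mul, mul_assoc, Finset.mul_sum])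
    (fun _ _ _ => by simp only [Pi.add_apply, mul_add, Finset.sum_add_distrib])
    (fun _ _ _ => by simp only [Pi.smul_apply, smul_eq_mul, mul_left_comm, Finset.mul_sum])

theorem symplecticForm_apply (a b : ι × Colour → ZMod 2) :
    symplecticForm ι a b = ∑ i, ∑ c, a (i, c) * b (i, c.opp) :=
  Fintype.sum_prod_type _

theorem symplecticForm_comm (a b : ι × Colour → ZMod 2) :
    symplecticForm ι a b = symplecticForm ι b a := by
  simp only [symplecticForm_apply, sum_colour _ Colour.Z, Colour.opp]
  exact Finset.sum_congr rfl fun i _ => by ring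

theorem symplecticForm_isRefl : (symplecticForm ι).IsRefl := fun a b h =>
  (symplecticForm_comm b a).trans h

theorem symplecticForm_single [DecidableEq ι] (i : ι) (c : Colour) (b : ι × Colour → ZMod 2) :
    symplecticForm ι (Pi.single (i, c) 1) b = b (i, c.opp) := by
  refine (Fintype.sum_eq_single (i, c) fun p hp => ?_).trans ?_
  · rw [Pi.single_eq_of_ne hp, zero_mul]
  · rw [Pi.single_eq_same, one_mul]

theorem symplecticForm_nondegenerate : (symplecticForm ι).Nondegenerate := by
  classical
  refine symplecticForm_isRefl.nondegenerate_iff_separatingRight.mpr fun b hb => ?_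
  funext ⟨i, c⟩
  rw [← Colour.opp_opp c, ← symplecticForm_single i c.opp b, hb, Pi.zero_apply]

theorem symplecticForm_pauliBits_extend {κ : Type*} [Fintype κ] {f : ι → κ}
    (hf : Function.Injective f) (b : κ × Colour → ZMod 2) (P : ι → Pauli) :
    symplecticForm κ b (pauliBits (Function.extend f P 1)) =
      symplecticForm ι (fun p => b (f p.1, p.2)) (pauliBits P) := by
  simp only [symplecticForm_apply, pauliBits_apply]
  refine (Fintype.sum_of_injective f hf _ _ (fun k hk => ?_) fun i => ?_).symm
  · simp [Function.extend_apply' _ _ _ hk]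
  · simp only [hf.extend_apply]

end PauliBits

/-- The nontrivial additive character of `ZMod 2`. -/
def signChar : AddChar (ZMod 2) ℂ := AddChar.zmodChar 2 (neg_one_sq (R := ℂ))

theorem signChar_sum {ι : Type*} (s : Finset ι) (f : ι → ZMod 2) :
    signChar (∑ i ∈ s, f i) = ∏ i ∈ s, signChar (f i) :=
  map_prod signChar.toMonoidHom (fun i => Multiplicative.ofAdd (f i)) s

theorem signChar_one : signChar 1 = -1 := by
  simp [signChar, AddChar.zmodChar_apply, ZMod.val_one]

theorem signChar_eq_one_iff (a : ZMod 2) : signChar a = 1 ↔ a = 0 := by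
  obtain rfl | rfl := eq_zero_or_eq_one a
  · simp
  · norm_num [signChar_one]

theorem Pauli.toMatrix_mul_comm (a b : Pauli) :
    a.toMatrix * b.toMatrix =
      signChar (∑ c, a.bit c * b.bit c.opp) • (b.toMatrix * a.toMatrix) := by
  rw [sum_colour _ .Z]
  cases a <;> cases b <;>
    simp [Pauli.bit, Pauli.toMatrix, Colour.opp, AddChar.map_add_eq_mul, signChar_one]

theorem pauliMatrix_mul_comm {n : ℕ} (P Q : PauliString n) :
    pauliMatrix P * pauliMatrix Q =
      signChar (symplecticForm _ (pauliBits P) (pauliBits Q)) •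
        (pauliMatrix Q * pauliMatrix P) := by
  ext y x
  simp only [pauliMatrix_mul_apply, Matrix.smul_apply, symplecticForm_apply, signChar_sum,
    Pauli.toMatrix_mul_comm (P _) (Q _), smul_eq_mul, Finset.prod_mul_distrib, pauliBits_apply]

theorem pauliMatrix_ne_zero {n : ℕ} (P : PauliString n) : pauliMatrix P ≠ 0 :=
  left_ne_zero_of_mul_eq_one (pauliMatrix_sq P)

theorem pauliMatrix_mul_eq {n : ℕ} (P Q : PauliString n) :
    ∃ k : ℕ, pauliMatrix P * pauliMatrix Q = Complex.I ^ k • pauliMatrix (P * Q) := by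
  choose k hk using fun i => (P i).toMatrix_mul (Q i)
  refine ⟨∑ i, k i, Matrix.ext fun y x => ?_⟩
  simp only [pauliMatrix_mul_apply, hk, Matrix.smul_apply, smul_eq_mul, Finset.prod_mul_distrib,
    Finset.prod_pow_eq_pow_sum, pauliMatrix, Pi.mul_apply]

theorem commute_pauliMatrix_iff {n : ℕ} (P Q : PauliString n) :
    Commute (pauliMatrix P) (pauliMatrix Q) ↔
      symplecticForm _ (pauliBits P) (pauliBits Q) = 0 := by
  obtain ⟨k, hk⟩ := pauliMatrix_mul_eq Q P
  have hne : pauliMatrix Q * pauliMatrix P ≠ 0 :=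
    hk ▸ smul_ne_zero (pow_ne_zero k Complex.I_ne_zero) (pauliMatrix_ne_zero _)
  rw [← signChar_eq_one_iff, commute_iff_eq, pauliMatrix_mul_comm, ← smul_left_inj (R := ℂ) hne,
    one_smul]

theorem eq_of_pauliMatrix_eq_smul {n : ℕ} {P Q : PauliString n} {c : ℂ}
    (h : pauliMatrix P = c • pauliMatrix Q) : P = Q := by
  have hc : c ≠ 0 := by
    rintro rfl
    exact pauliMatrix_ne_zero P (h.trans (zero_smul ℂ _))
  have hform (b : Fin n × Colour → ZMod 2) :
      symplecticForm _ (pauliBits P) b = symplecticForm _ (pauliBits Q) b := by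
    obtain ⟨R, rfl⟩ := pauliBits_surjective b
    have hzero : symplecticForm _ (pauliBits P) (pauliBits R) = 0 ↔
        symplecticForm _ (pauliBits Q) (pauliBits R) = 0 := by
      rw [← commute_pauliMatrix_iff, ← commute_pauliMatrix_iff, h, Commute.smul_left_iff₀ hc]
    generalize symplecticForm _ (pauliBits P) (pauliBits R) = a at hzero ⊢
    generalize symplecticForm _ (pauliBits Q) (pauliBits R) = a' at hzero ⊢
    revert a a'
    decide
  exact pauliBits_injective (sub_eq_zero.mp (symplecticForm_nondegenerate.1 _ fun b => by
    rw [map_sub, LinearMap.sub_apply, hform, sub_self]))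

theorem orthogonal_inf {K V : Type*} [Field K] [AddCommGroup V] [Module K V]
    [FiniteDimensional K V] {B : LinearMap.BilinForm K V} (hB : B.Nondegenerate) (hB' : B.IsRefl)
    (U W : Submodule K V) : B.orthogonal (U ⊓ W) = B.orthogonal U ⊔ B.orthogonal W := by
  have hle {T : Submodule K V} (hT : B.orthogonal T ≤ B.orthogonal U ⊔ B.orthogonal W) :
      B.orthogonal (B.orthogonal U ⊔ B.orthogonal W) ≤ T := by
    simpa only [LinearMap.BilinForm.orthogonal_orthogonal hB hB'] using
      LinearMap.BilinForm.orthogonal_le (B := B) hT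
  refine le_antisymm ?_ (sup_le (LinearMap.BilinForm.orthogonal_le inf_le_left)
    (LinearMap.BilinForm.orthogonal_le inf_le_right))
  rw [← LinearMap.BilinForm.orthogonal_orthogonal hB hB' (B.orthogonal U ⊔ B.orthogonal W)]
  exact LinearMap.BilinForm.orthogonal_le (le_inf (hle le_sup_left) (hle le_sup_right))

namespace Pauli

/-- The permutation of the basis labels underlying the matrix of a Pauli letter: `X` and `Y` flip
the label. -/
instance : MulAction Pauli (Fin 2) where
  smul p a := if p.bit .X = 0 then a else a.rev
  one_smul _ := rfl
  mul_smul p q a := by cases p <;> cases q <;> fin_cases a <;> rfl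

theorem smul_def (p : Pauli) (a : Fin 2) : p • a = if p.bit .X = 0 then a else a.rev := rfl

/-- The relative sign of the nonzero entries of the matrix of a Pauli letter, as a function of the
row. -/
def sign (p : Pauli) (a : Fin 2) : ℂ := if p.bit .Z = 0 then 1 else (-1) ^ a.val

theorem sign_mul_self (p : Pauli) (a : Fin 2) : p.sign a * p.sign a = 1 := by
  unfold sign
  split_ifs
  · exact one_mul 1
  · simp [← mul_pow]

theorem toMatrix_apply (p : Pauli) :
    ∃ θ : ℂ, θ ≠ 0 ∧ ∀ a b, p.toMatrix a b = if b = p • a then θ * p.sign a else 0 := by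
  refine ⟨p.toMatrix 0 (p • 0), ?_, fun a b => ?_⟩
  · cases p <;> simp [toMatrix, smul_def, bit, Matrix.one_apply]
  · cases p <;> fin_cases a <;> fin_cases b <;>
      simp [toMatrix, sign, smul_def, bit, Matrix.one_apply]

end Pauli

theorem pauli_smul_smul_self {ι : Type*} (P : ι → Pauli) (y : ι → Fin 2) : P • P • y = y :=
  inv_smul_smul P y

/-- The product of the signs of a family of Pauli letters. -/
def pauliSign {ι : Type*} [Fintype ι] (P : ι → Pauli) (x : ι → Fin 2) : ℂ :=
  ∏ i, (P i).sign (x i)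

theorem pauliSign_mul_self {ι : Type*} [Fintype ι] (P : ι → Pauli) (x : ι → Fin 2) :
    pauliSign P x * pauliSign P x = 1 := by
  rw [pauliSign, ← Finset.prod_mul_distrib]
  exact Finset.prod_eq_one fun i _ => (P i).sign_mul_self (x i)

theorem pauliMatrix_apply {n : ℕ} (P : PauliString n) :
    ∃ θ : ℂ, θ ≠ 0 ∧ ∀ y x, pauliMatrix P y x = if x = P • y then θ * pauliSign P y else 0 := by
  choose θ hθ h using fun i => (P i).toMatrix_apply
  refine ⟨∏ i, θ i, Finset.prod_ne_zero_iff.mpr fun i _ => hθ i, fun y x => ?_⟩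
  simp only [pauliMatrix, h, pauliSign, ← Finset.prod_mul_distrib, Finset.prod_ite_zero,
    Finset.mem_univ, true_imp_iff, funext_iff, Pi.smul_apply']

theorem exists_pauliMatrix_mul_eq_smul {m n : ℕ} {P : PauliString n} {Q : PauliString m}
    {M : Matrix (Fin n → Fin 2) (Fin m → Fin 2) ℂ} {ε : ℂ}
    (h : ∀ y x, M (P • y) (Q • x) = ε * (pauliSign Q x * pauliSign P y) * M y x) :
    ∃ c : ℂ, pauliMatrix P * M = c • (M * pauliMatrix Q) := by
  obtain ⟨θ, -, hP⟩ := pauliMatrix_apply P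
  obtain ⟨η, hη, hQ⟩ := pauliMatrix_apply Q
  refine ⟨θ * ε / η, Matrix.ext fun y x => ?_⟩
  have hleft : (pauliMatrix P * M) y x = θ * pauliSign P y * M (P • y) x := by
    simp [Matrix.mul_apply, hP]
  have hright : (M * pauliMatrix Q) y x = M y (Q • x) * (η * pauliSign Q (Q • x)) := by
    have heq (z : Fin m → Fin 2) : x = Q • z ↔ z = Q • x :=
      eq_comm.trans (smul_eq_iff_eq_inv_smul Q)
    simp [Matrix.mul_apply, hQ, heq]
  have hM : M (P • y) x = ε * (pauliSign Q (Q • x) * pauliSign P y) * M y (Q • x) := by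
    rw [← h, pauli_smul_smul_self]
  rw [Matrix.smul_apply, hleft, hright, hM, smul_eq_mul]
  field_simp
  linear_combination (θ * ε * pauliSign Q (Q • x) * M y (Q • x)) * pauliSign_mul_self P y

/-! ### The vertex rules and their orthogonals -/

section LegLabels

variable {E : Type*}

/-- The labels of the legs that come from labels of the edges: both legs of an edge carry its
label. -/
def legLabels : (E × Colour → ZMod 2) →ₗ[ZMod 2] ((E × Bool) × Colour → ZMod 2) :=
  LinearMap.funLeft (ZMod 2) (ZMod 2) fun p => (p.1.1, p.2)

@[simp]
theorem legLabels_apply (d : E × Colour → ZMod 2) (l : E × Bool) (c : Colour) :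
    legLabels d (l, c) = d (l.1, c) := rfl

theorem symplecticForm_legLabels [Fintype E] (d : E × Colour → ZMod 2)
    (φ : (E × Bool) × Colour → ZMod 2) :
    symplecticForm _ (legLabels d) φ =
      symplecticForm _ d fun p => φ ((p.1, true), p.2) + φ ((p.1, false), p.2) := by
  simp only [symplecticForm_apply, legLabels_apply, Fintype.sum_prod_type, Fintype.sum_bool,
    ← Finset.sum_add_distrib, mul_add]

theorem orthogonal_range_legLabels_le [Fintype E] :
    (symplecticForm (E × Bool)).orthogonal (LinearMap.range legLabels) ≤
      LinearMap.range legLabels := by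
  intro φ hφ
  have hsum : (fun p : E × Colour => φ ((p.1, true), p.2) + φ ((p.1, false), p.2)) = 0 :=
    symplecticForm_nondegenerate.2 _ fun d => by
      rw [← symplecticForm_legLabels]
      exact hφ _ ⟨d, rfl⟩
  have heq (e : E) (c : Colour) : φ ((e, true), c) = φ ((e, false), c) :=
    CharTwo.add_eq_zero.mp (congrFun hsum (e, c))
  refine ⟨fun p => φ ((p.1, true), p.2), funext fun ⟨⟨e, b⟩, c⟩ => ?_⟩
  cases b
  · exact heq e c
  · rfl

end LegLabels

namespace ZXDiagram

variable {V E : Type*} [Fintype V] [Fintype E] {m n : ℕ} (D : ZXDiagram V E m n)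

theorem mem_legs {l : E × Bool} {v : V} : l ∈ D.legs v ↔ D.ends l = v := by
  simp [legs]

theorem card_legs (v : V) : (D.legs v).card = Nat.card {l : E × Bool // D.ends l = v} := by
  classical
  rw [Nat.card_eq_fintype_card, Fintype.card_subtype]
  congr 1

/-- The labels of the legs that vanish on the legs of `v`. -/
def vanishingSpace (v : V) : Submodule (ZMod 2) ((E × Bool) × Colour → ZMod 2) where
  carrier := {a | ∀ l ∈ D.legs v, ∀ c, a (l, c) = 0}
  zero_mem' _ _ _ := rfl
  add_mem' ha hb l hl c := by rw [Pi.add_apply, ha l hl c, hb l hl c, add_zero]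
  smul_mem' r a ha l hl c := by rw [Pi.smul_apply, ha l hl c, smul_zero]

/-- The labels of the legs that obey the rule of a spider `v` of colour `own`, where the common
label `t` of the legs in the opposite colour is `1` if these legs are highlighted. -/
def spiderSpace (v : V) (own : Colour) : Submodule (ZMod 2) ((E × Bool) × Colour → ZMod 2) where
  carrier := {a | ∃ t, (∀ l ∈ D.legs v, a (l, own.opp) = t) ∧
    ∑ l ∈ D.legs v, a (l, own) = ((D.phase v).val : ZMod 2) * t}
  zero_mem' := ⟨0, fun _ _ => rfl, by simp⟩
  add_mem' := by
    rintro a b ⟨t, ha, ha'⟩ ⟨u, hb, hb'⟩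
    refine ⟨t + u, fun l hl => by rw [Pi.add_apply, ha l hl, hb l hl], ?_⟩
    simp only [Pi.add_apply, Finset.sum_add_distrib, ha', hb', mul_add]
  smul_mem' := by
    rintro r a ⟨t, ha, ha'⟩
    refine ⟨r * t, fun l hl => by rw [Pi.smul_apply, ha l hl, smul_eq_mul], ?_⟩
    simp only [Pi.smul_apply, smul_eq_mul, ← Finset.mul_sum, ha', mul_left_comm]

/-- The labels of the legs that obey the rule of a Hadamard node `v`. -/
def hadamardSpace (v : V) : Submodule (ZMod 2) ((E × Bool) × Colour → ZMod 2) where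
  carrier := {a | ∀ l ∈ D.legs v, ∀ l' ∈ D.legs v, l ≠ l' → a (l, .Z) = a (l', .X)}
  zero_mem' _ _ _ _ _ := rfl
  add_mem' ha hb l hl l' hl' h := by
    rw [Pi.add_apply, Pi.add_apply, ha l hl l' hl' h, hb l hl l' hl' h]
  smul_mem' r a ha l hl l' hl' h := by rw [Pi.smul_apply, Pi.smul_apply, ha l hl l' hl' h]

open Classical in
/-- The labels of the legs that obey the rule of the vertex `v`, and that moreover vanish on the
leg of `v` if `v` is a boundary node in `K`. -/
def vertexSpace (K : Set V) (v : V) : Submodule (ZMod 2) ((E × Bool) × Colour → ZMod 2) :=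
  match D.type v with
  | .Z => D.spiderSpace v .Z
  | .X => D.spiderSpace v .X
  | .H => D.hadamardSpace v
  | .B => if v ∈ K then D.vanishingSpace v else ⊤

/-- The labels of the legs that obey the rules of all vertices, and that vanish on the legs of the
boundary nodes in `K`. -/
def localSpace (K : Set V) : Submodule (ZMod 2) ((E × Bool) × Colour → ZMod 2) :=
  ⨅ v, D.vertexSpace K v

theorem vanishingSpace_le_spiderSpace (v : V) (own : Colour) :
    D.vanishingSpace v ≤ D.spiderSpace v own := fun a ha =>
  ⟨0, fun l hl => ha l hl _, by rw [mul_zero, Finset.sum_eq_zero fun l hl => ha l hl own]⟩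

theorem vanishingSpace_le_hadamardSpace (v : V) : D.vanishingSpace v ≤ D.hadamardSpace v :=
  fun a ha l hl l' hl' _ => by rw [ha l hl, ha l' hl']

theorem vanishingSpace_le_vertexSpace (K : Set V) (v : V) :
    D.vanishingSpace v ≤ D.vertexSpace K v := by
  unfold vertexSpace
  split
  · exact D.vanishingSpace_le_spiderSpace v _
  · exact D.vanishingSpace_le_spiderSpace v _
  · exact D.vanishingSpace_le_hadamardSpace v
  · split_ifs
    · exact le_rfl
    · exact le_top

theorem vertexSpace_antitone (v : V) : Antitone fun K : Set V => D.vertexSpace K v := by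
  intro K K' hK
  dsimp only [vertexSpace]
  split
  · exact le_rfl
  · exact le_rfl
  · exact le_rfl
  · split_ifs with h' h h
    · exact le_rfl
    · exact le_top
    · exact absurd (hK h) h'
    · exact le_rfl

/-- The labels of the legs that vanish on all legs that are not legs of `v`. -/
def supportedSpace (v : V) : Submodule (ZMod 2) ((E × Bool) × Colour → ZMod 2) :=
  ⨅ v' ≠ v, D.vanishingSpace v'

theorem single_mem_supportedSpace [DecidableEq E] {l : E × Bool} {v : V} (hl : l ∈ D.legs v)
    (c : Colour) : Pi.single (l, c) 1 ∈ D.supportedSpace v := by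
  simp only [supportedSpace, Submodule.mem_iInf]
  intro v' hv' l' hl' c'
  have hne : l' ≠ l := by
    rintro rfl
    rw [mem_legs] at hl hl'
    exact hv' (hl'.symm.trans hl)
  exact Pi.single_eq_of_ne (fun h => hne (congrArg Prod.fst h)) 1

theorem supportedSpace_inf_vertexSpace_le (K : Set V) (v : V) :
    D.supportedSpace v ⊓ D.vertexSpace K v ≤ D.localSpace K := by
  refine le_iInf fun v' => ?_
  obtain rfl | hne := eq_or_ne v' v
  · exact inf_le_right
  · exact inf_le_left.trans ((iInf₂_le v' hne).trans (D.vanishingSpace_le_vertexSpace K v'))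

theorem orthogonal_supportedSpace_inf_spiderSpace_le (v : V) (own : Colour) :
    (symplecticForm (E × Bool)).orthogonal (D.supportedSpace v ⊓ D.spiderSpace v own) ≤
      D.spiderSpace v own := by
  classical
  intro φ hφ
  have hne : own ≠ own.opp := by cases own <;> simp [Colour.opp]
  have hconst : ∀ l ∈ D.legs v, ∀ l' ∈ D.legs v, φ (l, own.opp) = φ (l', own.opp) := by
    intro l hl l' hl'
    have hpair : Pi.single (l, own) 1 + Pi.single (l', own) 1 ∈ D.spiderSpace v own := by
      refine ⟨0, fun k _ => ?_, ?_⟩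
      · simp [hne.symm]
      · simp [Pi.single_apply, Finset.sum_add_distrib, hl, hl', CharTwo.add_self_eq_zero]
    have h := hφ _ ⟨add_mem (D.single_mem_supportedSpace hl own)
      (D.single_mem_supportedSpace hl' own), hpair⟩
    rwa [map_add, LinearMap.add_apply, symplecticForm_single, symplecticForm_single,
      CharTwo.add_eq_zero] at h
  obtain hlegs | ⟨l, hl⟩ := (D.legs v).eq_empty_or_nonempty
  · exact ⟨0, by simp [hlegs], by simp [hlegs]⟩
  refine ⟨φ (l, own.opp), fun l' hl' => hconst l' hl' l hl, ?_⟩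
  have hall : ∑ l' ∈ D.legs v, Pi.single (l', own.opp) 1 +
      ((D.phase v).val : ZMod 2) • Pi.single (l, own) 1 ∈ D.spiderSpace v own := by
    refine ⟨1, fun k hk => ?_, ?_⟩
    · simp [Finset.sum_apply, Pi.single_apply, hne.symm, hk]
    · simp [Finset.sum_apply, Pi.single_apply, hl, hne]
  have h := hφ _ ⟨add_mem (sum_mem fun l' hl' => D.single_mem_supportedSpace hl' own.opp)
    (Submodule.smul_mem _ _ (D.single_mem_supportedSpace hl own)), hall⟩
  simpa only [map_add, map_sum, map_smul, LinearMap.add_apply, LinearMap.sum_apply,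
    LinearMap.smul_apply, symplecticForm_single, Colour.opp_opp, smul_eq_mul,
    CharTwo.add_eq_zero] using h

theorem orthogonal_supportedSpace_inf_hadamardSpace_le {v : V} (hv : D.type v = .H) :
    (symplecticForm (E × Bool)).orthogonal (D.supportedSpace v ⊓ D.hadamardSpace v) ≤
      D.hadamardSpace v := by
  classical
  intro φ hφ l hl l' hl' hne
  have hlegs : D.legs v = {l, l'} := by
    have hsub : {l, l'} ⊆ D.legs v := by simp [Finset.insert_subset_iff, hl, hl']
    refine (Finset.eq_of_subset_of_card_le hsub ?_).symm
    rw [Finset.card_pair hne, card_legs, D.hadamard_degree v hv]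
  have hpair : Pi.single (l, .X) 1 + Pi.single (l', .Z) 1 ∈ D.hadamardSpace v := by
    intro k hk k' hk' hkk
    rw [hlegs, Finset.mem_insert, Finset.mem_singleton] at hk hk'
    obtain rfl | rfl := hk <;> obtain rfl | rfl := hk' <;> simp_all
  have h := hφ _ ⟨add_mem (D.single_mem_supportedSpace hl .X)
    (D.single_mem_supportedSpace hl' .Z), hpair⟩
  rwa [map_add, LinearMap.add_apply, symplecticForm_single, symplecticForm_single,
    CharTwo.add_eq_zero] at h

theorem orthogonal_supportedSpace_le (v : V) :
    (symplecticForm (E × Bool)).orthogonal (D.supportedSpace v) ≤ D.vanishingSpace v := by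
  classical
  intro φ hφ l hl c
  rw [← Colour.opp_opp c, ← symplecticForm_single l c.opp φ]
  exact hφ _ (D.single_mem_supportedSpace hl c.opp)

theorem orthogonal_localSpace_le (K : Set V) :
    (symplecticForm (E × Bool)).orthogonal (D.localSpace K) ≤ D.localSpace Kᶜ := by
  refine le_iInf fun v => (LinearMap.BilinForm.orthogonal_le
    (D.supportedSpace_inf_vertexSpace_le K v)).trans ?_
  cases hv : D.type v <;> simp only [vertexSpace, hv]
  · exact D.orthogonal_supportedSpace_inf_spiderSpace_le v _
  · exact D.orthogonal_supportedSpace_inf_spiderSpace_le v _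
  · exact D.orthogonal_supportedSpace_inf_hadamardSpace_le hv
  · by_cases hK : v ∈ K
    · simp [hK]
    · simpa [hK] using D.orthogonal_supportedSpace_le v

end ZXDiagram

/-! ### Webs as vectors -/

section EdgeLetter

variable {E : Type*}

open Classical in
/-- The Pauli letter on an edge of a web, with `Y` where both colours are highlighted. -/
def edgeLetter (w : Set (E × Colour)) (e : E) : Pauli :=
  pauliOfColours ((e, .Z) ∈ w) ((e, .X) ∈ w)

open Classical in
theorem edgeLetter_bit (w : Set (E × Colour)) (e : E) (c : Colour) :
    (edgeLetter w e).bit c = if (e, c) ∈ w then 1 else 0 :=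
  Pauli.bit_pauliOfColours (fun c => (e, c) ∈ w) c

theorem edgeLetter_bit_eq_one {w : Set (E × Colour)} {e : E} {c : Colour} :
    (edgeLetter w e).bit c = 1 ↔ (e, c) ∈ w := by
  simp [edgeLetter_bit]

theorem edgeLetter_bit_eq_zero {w : Set (E × Colour)} {e : E} {c : Colour} :
    (edgeLetter w e).bit c = 0 ↔ (e, c) ∉ w := by
  simp [edgeLetter_bit]

theorem edgeLetter_symmDiff (w w' : Set (E × Colour)) :
    edgeLetter (w ∆ w') = edgeLetter w * edgeLetter w' := by
  classical
  refine pauliBits_injective (funext fun ⟨e, c⟩ => ?_)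
  rw [pauliBits_mul, Pi.add_apply]
  by_cases h : (e, c) ∈ w <;> by_cases h' : (e, c) ∈ w' <;>
    simp [edgeLetter_bit, Set.mem_symmDiff, h, h', CharTwo.add_self_eq_zero]

theorem pauliBits_edgeLetter_surjective :
    Function.Surjective fun w : Set (E × Colour) => pauliBits (edgeLetter w) := fun d => by
  classical
  refine ⟨{p | d p = 1}, funext fun ⟨e, c⟩ => ?_⟩
  simp only [pauliBits_apply, edgeLetter_bit, Set.mem_ofPred_eq]
  split_ifs with h
  · exact h.symm
  · exact ((eq_zero_or_eq_one _).resolve_right h).symm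

theorem edgeLetter_eq_one {w : Set (E × Colour)} {e : E} :
    edgeLetter w e = 1 ↔ ∀ c, (e, c) ∉ w := by
  simp only [← edgeLetter_bit_eq_zero]
  exact ⟨fun h c => by rw [h, Pauli.bit_one], fun h => Pauli.bit_injective (funext h)⟩

end EdgeLetter

namespace ZXDiagram

variable {V E : Type*} [Fintype V] [Fintype E] {m n : ℕ} (D : ZXDiagram V E m n)

theorem type_input (i : Fin m) : D.type (D.input i) = .B := (D.boundary (Sum.inl i)).2

theorem type_output (j : Fin n) : D.type (D.output j) = .B := (D.boundary (Sum.inr j)).2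

theorem input_injective : Function.Injective D.input := fun _ _ h =>
  Sum.inl_injective (D.boundary.injective (Subtype.ext h))

theorem output_injective : Function.Injective D.output := fun _ _ h =>
  Sum.inr_injective (D.boundary.injective (Subtype.ext h))

theorem input_ne_output (i : Fin m) (j : Fin n) : D.input i ≠ D.output j := fun h =>
  Sum.inl_ne_inr (D.boundary.injective (Subtype.ext h))

theorem exists_legs_eq_singleton {v : V} (hv : D.type v = .B) : ∃ l, D.legs v = {l} :=
  Finset.card_eq_one.mp ((D.card_legs v).trans (D.boundary_degree v hv))

/-- The leg of the `i`-th input node. -/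
def inLeg (i : Fin m) : E × Bool := (D.exists_legs_eq_singleton (D.type_input i)).choose

/-- The leg of the `j`-th output node. -/
def outLeg (j : Fin n) : E × Bool := (D.exists_legs_eq_singleton (D.type_output j)).choose

theorem legs_input (i : Fin m) : D.legs (D.input i) = {D.inLeg i} :=
  (D.exists_legs_eq_singleton (D.type_input i)).choose_spec

theorem legs_output (j : Fin n) : D.legs (D.output j) = {D.outLeg j} :=
  (D.exists_legs_eq_singleton (D.type_output j)).choose_spec

theorem ends_outLeg (j : Fin n) : D.ends (D.outLeg j) = D.output j := by
  rw [← mem_legs, legs_output, Finset.mem_singleton]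

theorem outLeg_injective : Function.Injective D.outLeg := fun j j' h =>
  D.output_injective (by rw [← ends_outLeg, h, ends_outLeg])

/-- The Pauli string read off the highlighted input edges. -/
def inputLetters (w : Set (E × Colour)) : PauliString m := fun i => edgeLetter w (D.inLeg i).1

theorem mem_highlighted {w : Set (E × Colour)} {v : V} {c : Colour} {l : E × Bool} :
    l ∈ D.highlighted w v c ↔ l ∈ D.legs v ∧ (l.1, c) ∈ w := by
  simp [highlighted]

theorem avoids_iff {w : Set (E × Colour)} {v : V} :
    D.Avoids w v ↔ ∀ l ∈ D.legs v, edgeLetter w l.1 = 1 := by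
  simp only [Avoids, Finset.eq_empty_iff_forall_notMem, mem_highlighted, not_and,
    edgeLetter_eq_one]
  exact ⟨fun h l hl c => h c l hl, fun h c l hl => h l hl c⟩

theorem out_apply (w : Set (E × Colour)) (j : Fin n) :
    D.out w j = edgeLetter w (D.outLeg j).1 := by
  classical
  refine Pauli.bit_injective (funext fun c => ?_)
  refine (Pauli.bit_pauliOfColours (fun c => (D.highlighted w (D.output j) c).Nonempty) c).trans ?_
  simp [Finset.Nonempty, mem_highlighted, legs_output, edgeLetter_bit]

theorem out_symmDiff (w w' : Set (E × Colour)) : D.out (w ∆ w') = D.out w * D.out w' :=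
  funext fun j => by simp only [Pi.mul_apply, out_apply, edgeLetter_symmDiff]

theorem forall_avoids_output_iff {w : Set (E × Colour)} :
    (∀ j, D.Avoids w (D.output j)) ↔ D.out w = 1 := by
  simp [avoids_iff, legs_output, funext_iff, out_apply]

theorem forall_avoids_input_iff {w : Set (E × Colour)} :
    (∀ i, D.Avoids w (D.input i)) ↔ D.inputLetters w = 1 := by
  simp [avoids_iff, legs_input, funext_iff, inputLetters]

theorem mem_spiderSpace_iff {w : Set (E × Colour)} {v : V} {own : Colour} :
    legLabels (pauliBits (edgeLetter w)) ∈ D.spiderSpace v own ↔ D.SpiderRule w v own own.opp := by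
  classical
  have hsum : ∑ l ∈ D.legs v, (edgeLetter w l.1).bit own =
      ((D.highlighted w v own).card : ZMod 2) := by
    simp [edgeLetter_bit, highlighted]
  have hnone : (∀ l ∈ D.legs v, (edgeLetter w l.1).bit own.opp = 0) ↔
      D.highlighted w v own.opp = ∅ := by
    simp [edgeLetter_bit_eq_zero, Finset.eq_empty_iff_forall_notMem, mem_highlighted]
  have hall : (∀ l ∈ D.legs v, (edgeLetter w l.1).bit own.opp = 1) ↔
      D.highlighted w v own.opp = D.legs v := by
    simp [edgeLetter_bit_eq_one, Finset.ext_iff, mem_highlighted]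
  have htwo (p : ZMod 2 → Prop) : (∃ t, p t) ↔ p 0 ∨ p 1 :=
    ⟨fun ⟨t, ht⟩ => by obtain rfl | rfl := eq_zero_or_eq_one t; exacts [.inl ht, .inr ht],
      fun h => h.elim (⟨_, ·⟩) (⟨_, ·⟩)⟩
  have hphase : (D.phase v = 0 ∨ D.phase v = 2) ∧ ¬(D.phase v = 1 ∨ D.phase v = 3) ∧
        ((D.phase v).val : ZMod 2) = 0 ∨
      ¬(D.phase v = 0 ∨ D.phase v = 2) ∧ (D.phase v = 1 ∨ D.phase v = 3) ∧
        ((D.phase v).val : ZMod 2) = 1 := by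
    generalize D.phase v = k
    revert k
    decide
  change (∃ t, (∀ l ∈ D.legs v, (edgeLetter w l.1).bit own.opp = t) ∧
    ∑ l ∈ D.legs v, (edgeLetter w l.1).bit own = ((D.phase v).val : ZMod 2) * t) ↔ _
  rw [htwo, hnone, hall, hsum, mul_zero, mul_one, SpiderRule]
  obtain ⟨heven, hodd, hval⟩ | ⟨heven, hodd, hval⟩ := hphase
  · rw [hval, ZMod.natCast_eq_zero_iff_even]
    tauto
  · rw [hval, ZMod.natCast_eq_zero_iff_even, ZMod.natCast_eq_one_iff_odd]
    tauto

theorem mem_hadamardSpace_iff {w : Set (E × Colour)} {v : V} :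
    legLabels (pauliBits (edgeLetter w)) ∈ D.hadamardSpace v ↔ D.HadamardRule w v := by
  have hbits (p q : E × Colour) : (edgeLetter w p.1).bit p.2 = (edgeLetter w q.1).bit q.2 ↔
      (p ∈ w ↔ q ∈ w) := by
    simp only [edgeLetter_bit]
    split_ifs <;> simp_all
  exact forall₅_congr fun l _ l' _ _ => hbits (l.1, .Z) (l'.1, .X)

theorem mem_vanishingSpace_iff {w : Set (E × Colour)} {v : V} :
    legLabels (pauliBits (edgeLetter w)) ∈ D.vanishingSpace v ↔ D.Avoids w v := by
  rw [avoids_iff]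
  refine forall₂_congr fun l _ => ⟨fun h => Pauli.bit_injective (funext h), fun h c => ?_⟩
  rw [legLabels_apply, pauliBits_apply, h, Pauli.bit_one]

theorem mem_localSpace_iff {w : Set (E × Colour)} {K : Set V} :
    legLabels (pauliBits (edgeLetter w)) ∈ D.localSpace K ↔
      D.IsPauliWeb w ∧ ∀ v ∈ K, D.type v = .B → D.Avoids w v := by
  simp only [localSpace, Submodule.mem_iInf, IsPauliWeb, ← forall_and]
  refine forall_congr' fun v => ?_
  cases hv : D.type v <;> simp only [vertexSpace, hv, reduceCtorEq]
  · simpa [Colour.opp] using D.mem_spiderSpace_iff (own := .Z)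
  · simpa [Colour.opp] using D.mem_spiderSpace_iff (own := .X)
  · simpa using D.mem_hadamardSpace_iff
  · by_cases hK : v ∈ K
    · simpa [hK] using D.mem_vanishingSpace_iff
    · simp [hK]

theorem vertexSpace_of_mem {K : Set V} {v : V} (hv : D.type v = .B) (hK : v ∈ K) :
    D.vertexSpace K v = D.vanishingSpace v := by
  simp only [vertexSpace, hv, if_pos hK]

theorem vertexSpace_of_notMem {K : Set V} {v : V} (hv : D.type v = .B) (hK : v ∉ K) :
    D.vertexSpace K v = ⊤ := by
  simp only [vertexSpace, hv, if_neg hK]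

theorem pauliBits_extend_outLeg_mem_vanishingSpace (P : PauliString n) {v : V}
    (hv : ∀ j, D.output j ≠ v) :
    pauliBits (Function.extend D.outLeg P 1) ∈ D.vanishingSpace v := by
  intro l hl c
  have hl' : l ∉ Set.range D.outLeg := by
    rintro ⟨j, rfl⟩
    exact hv j ((D.ends_outLeg j).symm.trans (D.mem_legs.mp hl))
  rw [pauliBits_apply, Function.extend_apply' _ _ _ hl', Pi.one_apply, Pauli.bit_one]

theorem symplecticForm_legLabels_extend_outLeg (w : Set (E × Colour)) (P : PauliString n) :
    symplecticForm _ (legLabels (pauliBits (edgeLetter w)))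
        (pauliBits (Function.extend D.outLeg P 1)) =
      symplecticForm _ (pauliBits (D.out w)) (pauliBits P) := by
  rw [symplecticForm_pauliBits_extend D.outLeg_injective]
  congr 2
  funext ⟨j, c⟩
  simp only [legLabels_apply, pauliBits_apply, out_apply]

theorem isPauliWeb_of_legLabels_add_eq {I : Set (Fin m)} {P : PauliString n}
    {w : Set (E × Colour)} {b : (E × Bool) × Colour → ZMod 2}
    (hb : b ∈ D.localSpace (D.input '' I)ᶜ)
    (hwb : legLabels (pauliBits (edgeLetter w)) + b =
      pauliBits (Function.extend D.outLeg P 1)) :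
    D.IsPauliWeb w ∧ (∀ i ∉ I, D.Avoids w (D.input i)) ∧ D.out w = P := by
  have hb_vertex (v : V) : b ∈ D.vertexSpace (D.input '' I)ᶜ v := (Submodule.mem_iInf _).mp hb v
  have hK : D.input '' Iᶜ ⊆ (D.input '' I)ᶜ := Set.image_compl_subset D.input_injective
  have hw : legLabels (pauliBits (edgeLetter w)) ∈ D.localSpace (D.input '' Iᶜ) := by
    refine (Submodule.mem_iInf _).mpr fun v => ?_
    by_cases hv : ∃ j, D.output j = v
    · obtain ⟨j, rfl⟩ := hv
      rw [D.vertexSpace_of_notMem (D.type_output j)]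
      · exact Submodule.mem_top
      · rintro ⟨i, -, hi⟩
        exact D.input_ne_output i j hi
    · rw [eq_sub_of_add_eq hwb]
      exact sub_mem (D.vanishingSpace_le_vertexSpace _ v
        (D.pauliBits_extend_outLeg_mem_vanishingSpace P (not_exists.mp hv)))
        (D.vertexSpace_antitone v hK (hb_vertex v))
  obtain ⟨hweb, havoids⟩ := D.mem_localSpace_iff.mp hw
  refine ⟨hweb, fun i hi => havoids _ ⟨i, hi, rfl⟩ (D.type_input i), ?_⟩
  refine pauliBits_injective (funext fun ⟨j, c⟩ => ?_)
  have hbj : b (D.outLeg j, c) = 0 := by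
    have hj := hb_vertex (D.output j)
    rw [D.vertexSpace_of_mem (D.type_output j)] at hj
    · exact hj _ (D.mem_legs.mpr (D.ends_outLeg j)) c
    · rintro ⟨i, -, hi⟩
      exact D.input_ne_output i j hi
  have hwj := congrFun hwb (D.outLeg j, c)
  rwa [Pi.add_apply, hbj, add_zero, legLabels_apply, pauliBits_apply, pauliBits_apply,
    D.outLeg_injective.extend_apply, ← out_apply] at hwj

theorem exists_isPauliWeb_out_eq (I : Set (Fin m)) {P : PauliString n}
    (hP : ∀ w, D.IsPauliWeb w → (∀ i ∈ I, D.Avoids w (D.input i)) →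
      Commute (pauliMatrix (D.out w)) (pauliMatrix P)) :
    ∃ w, D.IsPauliWeb w ∧ (∀ i ∉ I, D.Avoids w (D.input i)) ∧ D.out w = P := by
  have hmem : pauliBits (Function.extend D.outLeg P 1) ∈ (symplecticForm (E × Bool)).orthogonal
      (LinearMap.range legLabels ⊓ D.localSpace (D.input '' I)) := by
    rintro _ ⟨⟨d, rfl⟩, hd⟩
    obtain ⟨w, rfl⟩ := pauliBits_edgeLetter_surjective d
    obtain ⟨hw, hI⟩ := D.mem_localSpace_iff.mp hd
    refine (D.symplecticForm_legLabels_extend_outLeg w P).trans ?_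
    exact (commute_pauliMatrix_iff _ _).mp
      (hP w hw fun i hi => hI _ ⟨i, hi, rfl⟩ (D.type_input i))
  rw [orthogonal_inf symplecticForm_nondegenerate symplecticForm_isRefl] at hmem
  obtain ⟨_, ⟨d, rfl⟩, b, hb, hdb⟩ := Submodule.mem_sup.mp
    (sup_le_sup orthogonal_range_legLabels_le (D.orthogonal_localSpace_le _) hmem)
  obtain ⟨w, rfl⟩ := pauliBits_edgeLetter_surjective d
  exact ⟨w, D.isPauliWeb_of_legLabels_add_eq hb hdb⟩

end ZXDiagram

/-! ### Pauli webs push Pauli strings through a diagram -/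

theorem signChar_natCast (k : ℕ) : signChar k = (Complex.I ^ k) ^ 2 := by
  rw [signChar, AddChar.zmodChar_apply', ← pow_mul, mul_comm, pow_mul, Complex.I_sq]

theorem Pauli.sign_zero (p : Pauli) : p.sign 0 = 1 := by
  simp [sign]

theorem Pauli.sign_one (p : Pauli) : p.sign 1 = signChar (p.bit .Z) := by
  cases p <;> simp [sign, bit, signChar_one]

theorem Pauli.neg_one_pow_smul (p : Pauli) (a : Fin 2) :
    (-1 : ℂ) ^ (p • a).val = signChar (p.bit .X) * (-1) ^ a.val := by
  cases p <;> fin_cases a <;> simp [smul_def, bit, signChar_one]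

theorem Pauli.smul_eq_iff (p : Pauli) (a b : Fin 2) : p • a = b ↔ a = p • b :=
  smul_eq_iff_eq_inv_smul p

namespace ZXDiagram

variable {V E : Type*} [Fintype V] [Fintype E] {m n : ℕ} (D : ZXDiagram V E m n)

theorem exists_tensor_smul_eq_of_Z {P : E → Pauli} {v : V} (hv : D.type v = .Z)
    (h : legLabels (pauliBits P) ∈ D.spiderSpace v .Z) :
    ∃ ε : ℂ, ∀ σ : E → Fin 2,
      D.tensor (P • σ) v * ∏ l ∈ D.legs v, (P l.1).sign (σ l.1) = ε * D.tensor σ v := by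
  obtain ⟨t, hX, hZ⟩ := h
  replace hX : ∀ l ∈ D.legs v, (P l.1).bit .X = t := hX
  replace hZ : ∑ l ∈ D.legs v, (P l.1).bit .Z = ((D.phase v).val : ZMod 2) * t := hZ
  set u := Complex.I ^ (D.phase v).val
  let δ (σ : E → Fin 2) (a : Fin 2) : ℂ := ∏ l ∈ D.legs v, if σ l.1 = a then 1 else 0
  have htensor (σ : E → Fin 2) : D.tensor σ v = δ σ 0 + u * δ σ 1 := by
    simp only [tensor, hv, δ, u, Finset.prod_boole]
    congr
  have hδ (σ : E → Fin 2) {a b : Fin 2} (hab : ∀ l ∈ D.legs v, P l.1 • a = b) :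
      δ (P • σ) a * ∏ l ∈ D.legs v, (P l.1).sign (σ l.1) =
        δ σ b * ∏ l ∈ D.legs v, (P l.1).sign b := by
    rw [← Finset.prod_mul_distrib, ← Finset.prod_mul_distrib]
    refine Finset.prod_congr rfl fun l hl => ?_
    simp only [Pi.smul_apply', Pauli.smul_eq_iff, hab l hl, ite_mul, zero_mul]
    exact ite_congr rfl (fun h => by rw [h]) fun _ => rfl
  have hsign_zero : ∏ l ∈ D.legs v, (P l.1).sign 0 = 1 :=
    Finset.prod_eq_one fun l _ => Pauli.sign_zero _
  have hsign_one : ∏ l ∈ D.legs v, (P l.1).sign 1 = signChar ((D.phase v).val * t) := by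
    simp only [Pauli.sign_one, ← signChar_sum, hZ]
  obtain rfl | rfl := eq_zero_or_eq_one t
  · have hfix (a : Fin 2) : ∀ l ∈ D.legs v, P l.1 • a = a := fun l hl => by
      rw [Pauli.smul_def, if_pos (hX l hl)]
    refine ⟨1, fun σ => ?_⟩
    rw [htensor, htensor, add_mul, mul_assoc, hδ σ (hfix 0), hδ σ (hfix 1), hsign_zero,
      hsign_one, mul_zero, AddChar.map_zero_eq_one, mul_one, mul_one, one_mul]
  · have hflip (a : Fin 2) : ∀ l ∈ D.legs v, P l.1 • a = a.rev := fun l hl => by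
      rw [Pauli.smul_def, hX l hl, if_neg one_ne_zero]
    refine ⟨u, fun σ => ?_⟩
    rw [htensor, htensor, add_mul, mul_assoc, hδ σ (b := 1) (hflip 0), hδ σ (b := 0) (hflip 1),
      hsign_zero, hsign_one, mul_one, mul_one, signChar_natCast]
    ring

theorem exists_tensor_smul_eq_of_X {P : E → Pauli} {v : V} (hv : D.type v = .X)
    (h : legLabels (pauliBits P) ∈ D.spiderSpace v .X) :
    ∃ ε : ℂ, ∀ σ : E → Fin 2,
      D.tensor (P • σ) v * ∏ l ∈ D.legs v, (P l.1).sign (σ l.1) = ε * D.tensor σ v := by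
  obtain ⟨t, hZ, hX⟩ := h
  replace hZ : ∀ l ∈ D.legs v, (P l.1).bit .Z = t := hZ
  replace hX : ∑ l ∈ D.legs v, (P l.1).bit .X = ((D.phase v).val : ZMod 2) * t := hX
  set u := Complex.I ^ (D.phase v).val
  let N (σ : E → Fin 2) : ℂ := ∏ l ∈ D.legs v, (-1) ^ (σ l.1).val
  have htensor (σ : E → Fin 2) :
      D.tensor σ v = (∏ _l ∈ D.legs v, 1 / (√2 : ℂ)) * (1 + u * N σ) := by
    simp only [tensor, hv, N, u, Finset.prod_div_distrib, Finset.prod_const_one]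
    ring
  have hN_smul (σ : E → Fin 2) : N (P • σ) = signChar ((D.phase v).val * t) * N σ := by
    simp only [N, Pi.smul_apply', Pauli.neg_one_pow_smul, Finset.prod_mul_distrib, ← signChar_sum,
      hX]
  obtain rfl | rfl := eq_zero_or_eq_one t
  · have hsign (σ : E → Fin 2) : ∏ l ∈ D.legs v, (P l.1).sign (σ l.1) = 1 :=
      Finset.prod_eq_one fun l hl => by rw [Pauli.sign, if_pos (hZ l hl)]
    refine ⟨1, fun σ => ?_⟩
    rw [htensor, htensor, hsign, hN_smul, mul_zero, AddChar.map_zero_eq_one, mul_one, one_mul,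
      one_mul]
  · have hsign (σ : E → Fin 2) : ∏ l ∈ D.legs v, (P l.1).sign (σ l.1) = N σ :=
      Finset.prod_congr rfl fun l hl => by rw [Pauli.sign, hZ l hl, if_neg one_ne_zero]
    have hN_sq (σ : E → Fin 2) : N σ * N σ = 1 := by
      rw [← Finset.prod_mul_distrib]
      exact Finset.prod_eq_one fun l _ => by rw [← mul_pow]; simp
    have hu : u ^ 4 = 1 := by
      rw [← pow_mul, mul_comm, pow_mul, Complex.I_pow_four, one_pow]
    refine ⟨u ^ 3, fun σ => ?_⟩
    rw [htensor, htensor, hsign, hN_smul, mul_one, signChar_natCast]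
    linear_combination (∏ _l ∈ D.legs v, 1 / (√2 : ℂ)) * (u ^ 3 * hN_sq σ - N σ * hu)

theorem exists_tensor_smul_eq_of_H {P : E → Pauli} {v : V} (hv : D.type v = .H)
    (h : legLabels (pauliBits P) ∈ D.hadamardSpace v) :
    ∃ ε : ℂ, ∀ σ : E → Fin 2,
      D.tensor (P • σ) v * ∏ l ∈ D.legs v, (P l.1).sign (σ l.1) = ε * D.tensor σ v := by
  classical
  obtain ⟨l, l', hne, hlegs⟩ :=
    Finset.card_eq_two.mp ((D.card_legs v).trans (D.hadamard_degree v hv))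
  have hl : l ∈ D.legs v := by simp [hlegs]
  have hl' : l' ∈ D.legs v := by simp [hlegs]
  have hZX : (P l.1).bit .Z = (P l'.1).bit .X := h l hl l' hl' hne
  have hXZ : (P l'.1).bit .Z = (P l.1).bit .X := h l' hl' l hl hne.symm
  let χ (a b : Fin 2) : ℂ := if a = 1 ∧ b = 1 then -1 else 1
  have htensor (σ : E → Fin 2) : D.tensor σ v = 1 / (√2 : ℂ) * χ (σ l.1) (σ l'.1) := by
    simp [tensor, hv, hlegs, χ]
  have hχ (a b : Fin 2) : χ (P l.1 • a) (P l'.1 • b) * ((P l.1).sign a * (P l'.1).sign b) =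
      χ (P l.1 • 0) (P l'.1 • 0) * χ a b := by
    simp only [Pauli.sign, Pauli.smul_def, hZX, hXZ]
    fin_cases a <;> fin_cases b <;> split_ifs <;> simp [χ]
  refine ⟨χ (P l.1 • 0) (P l'.1 • 0), fun σ => ?_⟩
  rw [htensor, htensor, hlegs, Finset.prod_pair hne, mul_assoc, Pi.smul_apply', Pi.smul_apply',
    hχ, mul_left_comm]

theorem prod_legs {M : Type*} [CommMonoid M] (f : E × Bool → M) :
    ∏ v, ∏ l ∈ D.legs v, f l = ∏ l, f l := by
  classical
  rw [← Finset.prod_fiberwise (s := Finset.univ) (g := D.ends)]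
  exact Finset.prod_congr rfl fun v _ => Finset.prod_congr (by ext; simp [legs]) fun _ _ => rfl

theorem prod_boundary {M : Type*} [CommMonoid M] {f : V → M} (hf : ∀ v, D.type v ≠ .B → f v = 1) :
    ∏ v, f v = (∏ i, f (D.input i)) * ∏ j, f (D.output j) := by
  classical
  rw [← Finset.prod_filter_of_ne (p := fun v => D.type v = .B)
    (fun v _ hv => not_imp_comm.mp (hf v) hv),
    Finset.prod_subtype (p := fun v => D.type v = .B) _ (by simp),
    ← D.boundary.prod_comp, Fintype.prod_sum_type]
  rfl

theorem prod_legs_sign (P : E → Pauli) (σ : E → Fin 2) :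
    ∏ v, ∏ l ∈ D.legs v, (P l.1).sign (σ l.1) = 1 := by
  rw [prod_legs, Fintype.prod_prod_type]
  exact Finset.prod_eq_one fun e _ => by rw [Fintype.prod_bool, Pauli.sign_mul_self]

open Classical in
theorem exists_tensor_smul_eq {w : Set (E × Colour)} (hw : D.IsPauliWeb w) (v : V) :
    ∃ ε : ℂ, ∀ σ : E → Fin 2,
      D.tensor (edgeLetter w • σ) v * ∏ l ∈ D.legs v, (edgeLetter w l.1).sign (σ l.1) =
        ε * (if D.type v = .B then ∏ l ∈ D.legs v, (edgeLetter w l.1).sign (σ l.1) else 1) *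
          D.tensor σ v := by
  have hv := hw v
  cases htype : D.type v <;>
    simp only [htype, reduceCtorEq, if_true, if_false, mul_one] at hv ⊢
  · exact D.exists_tensor_smul_eq_of_Z htype (D.mem_spiderSpace_iff.mpr hv)
  · exact D.exists_tensor_smul_eq_of_X htype (D.mem_spiderSpace_iff.mpr hv)
  · exact D.exists_tensor_smul_eq_of_H htype (D.mem_hadamardSpace_iff.mpr hv)
  · exact ⟨1, fun σ => by simp [tensor, htype]⟩

theorem exists_prod_tensor_smul_eq {w : Set (E × Colour)} (hw : D.IsPauliWeb w) :
    ∃ ε : ℂ, ∀ σ : E → Fin 2, ∏ v, D.tensor (edgeLetter w • σ) v =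
      ε * (pauliSign (D.inputLetters w) (fun i => σ (D.inLeg i).1) *
        pauliSign (D.out w) fun j => σ (D.outLeg j).1) * ∏ v, D.tensor σ v := by
  classical
  choose ε h using D.exists_tensor_smul_eq hw
  refine ⟨∏ v, ε v, fun σ => ?_⟩
  have hprod := Finset.prod_congr (rfl : Finset.univ = Finset.univ) fun v _ => h v σ
  rw [Finset.prod_mul_distrib, Finset.prod_mul_distrib, Finset.prod_mul_distrib, prod_legs_sign,
    mul_one, D.prod_boundary fun v hv => if_neg hv] at hprod
  simpa only [type_input, type_output, if_true, legs_input, legs_output, Finset.prod_singleton,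
    pauliSign, inputLetters, out_apply] using hprod

open Classical in
theorem interp_apply (y : Fin n → Fin 2) (x : Fin m → Fin 2) :
    D.interp y x = ∑ σ : E → Fin 2,
      if (fun i => σ (D.inLeg i).1) = x ∧ (fun j => σ (D.outLeg j).1) = y
      then ∏ v, D.tensor σ v else 0 := by
  simp only [interp, legs_input, legs_output, Finset.mem_singleton, forall_eq, funext_iff]

theorem exists_interp_smul_eq {w : Set (E × Colour)} (hw : D.IsPauliWeb w) :
    ∃ ε : ℂ, ∀ y x, D.interp (D.out w • y) (D.inputLetters w • x) =
      ε * (pauliSign (D.inputLetters w) x * pauliSign (D.out w) y) * D.interp y x := by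
  classical
  obtain ⟨ε, h⟩ := D.exists_prod_tensor_smul_eq hw
  refine ⟨ε, fun y x => ?_⟩
  have hin (σ : E → Fin 2) : (fun i => (edgeLetter w • σ) (D.inLeg i).1) =
      D.inputLetters w • fun i => σ (D.inLeg i).1 := rfl
  have hout (σ : E → Fin 2) : (fun j => (edgeLetter w • σ) (D.outLeg j).1) =
      D.out w • fun j => σ (D.outLeg j).1 :=
    funext fun j => by rw [Pi.smul_apply', Pi.smul_apply', out_apply]
  rw [interp_apply, interp_apply, Finset.mul_sum,
    ← Equiv.sum_comp (MulAction.toPerm (edgeLetter w))]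
  refine Finset.sum_congr rfl fun σ _ => ?_
  simp only [MulAction.toPerm_apply, hin, hout, smul_left_cancel_iff, h]
  split_ifs with hσ
  · rw [hσ.1, hσ.2]
  · rw [mul_zero]

theorem exists_pauliMatrix_out_mul_interp {w : Set (E × Colour)} (hw : D.IsPauliWeb w) :
    ∃ c : ℂ, pauliMatrix (D.out w) * D.interp =
      c • (D.interp * pauliMatrix (D.inputLetters w)) := by
  obtain ⟨ε, h⟩ := D.exists_interp_smul_eq hw
  exact exists_pauliMatrix_mul_eq_smul h

theorem Represents.exists_pauliMatrix_out_mul {M : Matrix (Fin n → Fin 2) (Fin m → Fin 2) ℂ}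
    (hD : D.Represents M) {w : Set (E × Colour)} (hw : D.IsPauliWeb w) :
    ∃ c : ℂ, pauliMatrix (D.out w) * M =
      c • (M * pauliMatrix (D.inputLetters w)) := by
  obtain ⟨a, ha, hinterp⟩ := hD
  obtain ⟨c, h⟩ := D.exists_pauliMatrix_out_mul_interp hw
  refine ⟨c, smul_right_injective _ ha ?_⟩
  simpa only [hinterp, Matrix.mul_smul, Matrix.smul_mul, smul_comm c a] using h

end ZXDiagram

/-! ### Stabilisers and the normaliser -/

section Stabilisers

variable {n : ℕ} {M : Matrix (Fin n → Fin 2) (Fin n → Fin 2) ℂ}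

theorem coe_pauliUnitary (P : PauliString n) :
    (pauliUnitary P : Matrix (Fin n → Fin 2) (Fin n → Fin 2) ℂ) = pauliMatrix P := rfl

theorem pauliUnitary_mem_pauliGroup (P : PauliString n) : pauliUnitary P ∈ pauliGroup n :=
  ⟨0, P, by rw [coe_pauliUnitary, pow_zero, one_smul]⟩

theorem pauliUnitary_inv (P : PauliString n) : (pauliUnitary P)⁻¹ = pauliUnitary P :=
  inv_eq_of_mul_eq_one_left (Subtype.ext (pauliMatrix_sq P))

/-- The unitary `s` is the Pauli string `P` up to a sign. -/
def IsSignedPauli (s : QubitUnitary n) (P : PauliString n) : Prop :=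
  (s : Matrix (Fin n → Fin 2) (Fin n → Fin 2) ℂ) = pauliMatrix P ∨
    (s : Matrix (Fin n → Fin 2) (Fin n → Fin 2) ℂ) = -pauliMatrix P

theorem isSignedPauli_iff {s : QubitUnitary n} {P : PauliString n} :
    IsSignedPauli s P ↔ ∃ k : ℕ, s.1 = (-1 : ℂ) ^ k • pauliMatrix P := by
  constructor
  · rintro (hs | hs)
    · exact ⟨0, by rw [hs, pow_zero, one_smul]⟩
    · exact ⟨1, by rw [hs, pow_one, neg_one_smul]⟩
  · rintro ⟨k, hs⟩
    exact (neg_one_pow_eq_or ℂ k).imp (fun hk => by rw [hs, hk, one_smul])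
      (fun hk => by rw [hs, hk, neg_one_smul])

/-- `P` stabilises `M` up to a scalar, which is necessarily a sign when `M` is non-zero. -/
def IsStabiliserString {m n : ℕ} (M : Matrix (Fin n → Fin 2) (Fin m → Fin 2) ℂ)
    (P : PauliString n) : Prop :=
  ∃ c : ℂ, pauliMatrix P * M = c • M

theorem eq_one_or_eq_neg_one_of_pauliMatrix_mul_eq_smul {m n : ℕ}
    {M : Matrix (Fin n → Fin 2) (Fin m → Fin 2) ℂ} (hM : M ≠ 0) {P : PauliString n} {c : ℂ}
    (h : pauliMatrix P * M = c • M) : c = 1 ∨ c = -1 := by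
  rw [← mul_self_eq_one_iff, ← smul_left_inj (R := ℂ) hM, one_smul]
  calc (c * c) • M = pauliMatrix P * (pauliMatrix P * M) := by
        rw [h, Matrix.mul_smul, h, smul_smul]
    _ = M := by rw [← Matrix.mul_assoc, pauliMatrix_sq, Matrix.one_mul]

theorem IsStabiliserString.exists_mem_stabiliserGroup (hM : M ≠ 0) {P : PauliString n}
    (hP : IsStabiliserString M P) : ∃ s ∈ stabiliserGroup M, IsSignedPauli s P := by
  obtain ⟨c, hc⟩ := hP
  rcases eq_one_or_eq_neg_one_of_pauliMatrix_mul_eq_smul hM hc with rfl | rfl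
  · exact ⟨pauliUnitary P, ⟨pauliUnitary_mem_pauliGroup P, hc.trans (one_smul ℂ M)⟩, .inl rfl⟩
  · refine ⟨-pauliUnitary P, ⟨⟨2, P, ?_⟩, ?_⟩, .inr rfl⟩
    · rw [Unitary.coe_neg, coe_pauliUnitary, Complex.I_sq, neg_one_smul]
    · rw [Unitary.coe_neg, coe_pauliUnitary, neg_mul, hc, neg_one_smul, neg_neg]

theorem exists_isStabiliserString_of_mem (hM : M ≠ 0) {s : QubitUnitary n}
    (hs : s ∈ stabiliserGroup M) : ∃ P, IsStabiliserString M P ∧ IsSignedPauli s P := by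
  obtain ⟨⟨k, P, hP⟩, hsM⟩ := hs
  have hPM : pauliMatrix P * M = (Complex.I ^ k)⁻¹ • M := by
    conv_rhs => rw [← hsM]
    rw [hP, Matrix.smul_mul, inv_smul_smul₀ (pow_ne_zero k Complex.I_ne_zero)]
  refine ⟨P, ⟨_, hPM⟩, ?_⟩
  rw [IsSignedPauli, hP]
  exact (eq_one_or_eq_neg_one_of_pauliMatrix_mul_eq_smul hM hPM).imp
    (fun h => by rw [inv_eq_one.mp h, one_smul])
    (fun h => by rw [inv_eq_iff_eq_inv.mp h, inv_neg_one, neg_one_smul])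

theorem IsSignedPauli.string_unique {s : QubitUnitary n} {P Q : PauliString n}
    (hP : IsSignedPauli s P) (hQ : IsSignedPauli s Q) : P = Q := by
  obtain ⟨k, hk⟩ := isSignedPauli_iff.mp hP
  obtain ⟨l, hl⟩ := isSignedPauli_iff.mp hQ
  refine eq_of_pauliMatrix_eq_smul (c := (-1) ^ k * (-1) ^ l) ?_
  rw [mul_smul, ← hl, hk, smul_smul, ← mul_pow, neg_one_mul, neg_neg, one_pow, one_smul]

theorem eq_one_of_smul_mem_stabiliserGroup (hM : M ≠ 0) {s s' : QubitUnitary n}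
    (hs : s ∈ stabiliserGroup M) (hs' : s' ∈ stabiliserGroup M) {c : ℂ}
    (h : s'.1 = c • s.1) : c = 1 := by
  rw [← smul_left_inj (R := ℂ) hM, one_smul]
  calc c • M = s'.1 * M := by rw [h, Matrix.smul_mul, hs.2]
    _ = M := hs'.2

theorem IsSignedPauli.eq_of_mem_stabiliserGroup (hM : M ≠ 0) {s s' : QubitUnitary n}
    {P : PauliString n} (hs : s ∈ stabiliserGroup M) (hs' : s' ∈ stabiliserGroup M)
    (hP : IsSignedPauli s P) (hP' : IsSignedPauli s' P) : s = s' := by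
  obtain ⟨k, hk⟩ := isSignedPauli_iff.mp hP
  obtain ⟨l, hl⟩ := isSignedPauli_iff.mp hP'
  have hss' : s'.1 = ((-1 : ℂ) ^ l * (-1) ^ k) • s.1 := by
    rw [hk, smul_smul, mul_assoc, ← mul_pow, neg_one_mul, neg_neg, one_pow, mul_one, hl]
  refine Subtype.ext ?_
  rw [hss', eq_one_of_smul_mem_stabiliserGroup hM hs hs' hss', one_smul]

theorem pauliUnitary_mem_pauliNormalizer_iff (hM : M ≠ 0) {P : PauliString n} :
    pauliUnitary P ∈ pauliNormalizer (stabiliserGroup M) ↔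
      ∀ Q, IsStabiliserString M Q → Commute (pauliMatrix P) (pauliMatrix Q) := by
  constructor
  · rintro ⟨hnorm, -⟩ Q hQ
    obtain ⟨s, hs, hsQ⟩ := hQ.exists_mem_stabiliserGroup hM
    obtain ⟨k, hk⟩ := isSignedPauli_iff.mp hsQ
    have hconj := (Subgroup.mem_normalizer_iff.mp hnorm s).mp hs
    have hsign := eq_one_of_smul_mem_stabiliserGroup hM hs hconj
      (c := signChar (symplecticForm _ (pauliBits P) (pauliBits Q))) <| calc
        (pauliUnitary P * s * (pauliUnitary P)⁻¹).1
          = (-1 : ℂ) ^ k • (pauliMatrix P * pauliMatrix Q * pauliMatrix P) := by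
            rw [pauliUnitary_inv, Submonoid.coe_mul, Submonoid.coe_mul, coe_pauliUnitary, hk,
              Matrix.mul_smul, Matrix.smul_mul]
        _ = _ := by
            rw [pauliMatrix_mul_comm, Matrix.smul_mul, Matrix.mul_assoc, pauliMatrix_sq, mul_one,
              hk, smul_comm]
    rw [commute_iff_eq, pauliMatrix_mul_comm, hsign, one_smul]
  · intro hP
    refine ⟨Subgroup.centralizer_le_normalizer _ (Subgroup.mem_centralizer_iff.mpr fun s hs => ?_),
      pauliUnitary_mem_pauliGroup P⟩
    obtain ⟨Q, hQ, hsQ⟩ := exists_isStabiliserString_of_mem hM hs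
    obtain ⟨k, hk⟩ := isSignedPauli_iff.mp hsQ
    refine Subtype.ext ?_
    rw [Submonoid.coe_mul, Submonoid.coe_mul, coe_pauliUnitary, hk, Matrix.smul_mul,
      Matrix.mul_smul, (hP Q hQ).eq]

theorem phaseGroup_le_center : phaseGroup n ≤ Subgroup.center (QubitUnitary n) := by
  rintro U ⟨k, hU⟩
  refine Subgroup.mem_center_iff.mpr fun V => Subtype.ext ?_
  rw [Submonoid.coe_mul, Submonoid.coe_mul, hU, Matrix.mul_smul, mul_one, Matrix.smul_mul, one_mul]

instance : (phaseGroup n).Normal where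
  conj_mem z hz U := by
    rwa [Subgroup.mem_center_iff.mp (phaseGroup_le_center hz) U, mul_inv_cancel_right]

theorem pauliUnitary_inv_mul_mem_sup_iff (hM : M ≠ 0) {P Q : PauliString n} :
    (pauliUnitary P)⁻¹ * pauliUnitary Q ∈ stabiliserGroup M ⊔ phaseGroup n ↔
      IsStabiliserString M (P * Q) := by
  obtain ⟨k, hk⟩ := pauliMatrix_mul_eq P Q
  have hPQ : (pauliUnitary P * pauliUnitary Q).1 = Complex.I ^ k • pauliMatrix (P * Q) := hk
  have hI := pow_ne_zero k Complex.I_ne_zero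
  rw [pauliUnitary_inv, Subgroup.mem_sup_of_normal_right]
  constructor
  · rintro ⟨s, hs, z, ⟨l, hz⟩, hsz⟩
    refine ⟨(Complex.I ^ k)⁻¹ * Complex.I ^ l, ?_⟩
    rw [← inv_smul_smul₀ hI (pauliMatrix (P * Q)), ← hPQ, ← hsz, Submonoid.coe_mul, hz,
      Matrix.mul_smul, mul_one, smul_smul, Matrix.smul_mul, hs.2]
  · intro hstab
    obtain ⟨s, hs, hsPQ⟩ := hstab.exists_mem_stabiliserGroup hM
    obtain ⟨l, hl⟩ := isSignedPauli_iff.mp hsPQ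
    refine ⟨s, hs, s⁻¹ * (pauliUnitary P * pauliUnitary Q), ⟨2 * l + k, ?_⟩,
      mul_inv_cancel_left _ _⟩
    rw [Submonoid.coe_mul, hPQ, Matrix.UnitaryGroup.inv_val, hl, star_smul, pauliMatrix_star,
      Matrix.smul_mul, Matrix.mul_smul, pauliMatrix_sq, smul_smul, pow_add, pow_mul, Complex.I_sq]
    simp only [star_pow, star_neg, star_one]

theorem exists_eq_mk_pauliUnitary (x : Logicals (stabiliserGroup M)) :
    ∃ (P : PauliString n) (hP : pauliUnitary P ∈ pauliNormalizer (stabiliserGroup M)),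
      x = QuotientGroup.mk ⟨pauliUnitary P, hP⟩ := by
  obtain ⟨⟨U, hU, k, P, hUP⟩, rfl⟩ := QuotientGroup.mk_surjective x
  have hphase : U⁻¹ * pauliUnitary P ∈ phaseGroup n := by
    refine ⟨3 * k, ?_⟩
    rw [Submonoid.coe_mul, Matrix.UnitaryGroup.inv_val, hUP, star_smul, pauliMatrix_star,
      coe_pauliUnitary, Matrix.smul_mul, pauliMatrix_sq, star_pow, pow_mul, Complex.I_pow_three,
      Complex.star_def, Complex.conj_I]
  have hnorm : U⁻¹ * pauliUnitary P ∈ Subgroup.normalizer (stabiliserGroup M) :=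
    Subgroup.center_le_normalizer _ (phaseGroup_le_center hphase)
  have hP : pauliUnitary P ∈ Subgroup.normalizer (stabiliserGroup M) := by
    rw [← mul_inv_cancel_left U (pauliUnitary P)]
    exact Subgroup.mul_mem _ hU hnorm
  exact ⟨P, ⟨hP, pauliUnitary_mem_pauliGroup P⟩,
    QuotientGroup.eq.mpr (Subgroup.mem_subgroupOf.mpr (Subgroup.mem_sup_right hphase))⟩

end Stabilisers

theorem pauliMatrix_mul_ne_zero {m n : ℕ} (P : PauliString n)
    {M : Matrix (Fin n → Fin 2) (Fin m → Fin 2) ℂ} (hM : M ≠ 0) : pauliMatrix P * M ≠ 0 := by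
  intro h0
  refine hM ?_
  rw [← Matrix.one_mul M, ← pauliMatrix_sq P, Matrix.mul_assoc, h0, Matrix.mul_zero]

namespace ZXDiagram

variable {V E : Type*} [Fintype V] [Fintype E] {m n : ℕ} (D : ZXDiagram V E m n)
  {M : Matrix (Fin n → Fin 2) (Fin m → Fin 2) ℂ}

theorem isStabiliserString_out (hD : D.Represents M) {w : Set (E × Colour)}
    (hw : w ∈ D.stabilisingWebs) : IsStabiliserString M (D.out w) := by
  obtain ⟨c, hc⟩ := Represents.exists_pauliMatrix_out_mul D hD hw.1
  refine ⟨c, ?_⟩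
  rw [hc, (D.forall_avoids_input_iff).mp hw.2]
  exact congrArg (c • ·) ((congrArg (M * ·) pauliMatrix_one).trans (Matrix.mul_one M))

theorem commute_out_of_isStabiliserString (hM : M ≠ 0) (hD : D.Represents M)
    {w : Set (E × Colour)} (hw : D.IsPauliWeb w) {Q : PauliString n}
    (hQ : IsStabiliserString M Q) : Commute (pauliMatrix (D.out w)) (pauliMatrix Q) := by
  obtain ⟨c, hc⟩ := Represents.exists_pauliMatrix_out_mul D hD hw
  obtain ⟨d, hd⟩ := hQ
  set P := pauliMatrix (D.out w)
  have hPQ : P * pauliMatrix Q * M = pauliMatrix Q * P * M := by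
    rw [Matrix.mul_assoc, hd, Matrix.mul_smul, Matrix.mul_assoc, hc, Matrix.mul_smul,
      ← Matrix.mul_assoc, hd, Matrix.smul_mul, smul_comm]
  have hne : pauliMatrix Q * P * M ≠ 0 := by
    rw [Matrix.mul_assoc]
    exact pauliMatrix_mul_ne_zero Q (pauliMatrix_mul_ne_zero _ hM)
  rw [commute_pauliMatrix_iff, ← signChar_eq_one_iff, ← smul_left_inj (R := ℂ) hne, one_smul,
    ← Matrix.smul_mul, ← pauliMatrix_mul_comm, hPQ]

theorem isStabiliserString_iff_exists_stabilisingWeb (hM : M ≠ 0) (hD : D.Represents M)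
    {P : PauliString n} : IsStabiliserString M P ↔ ∃ w ∈ D.stabilisingWebs, D.out w = P := by
  constructor
  · intro hP
    obtain ⟨w, hw, hin, hout⟩ := D.exists_isPauliWeb_out_eq ∅ (P := P) fun w hw _ =>
      D.commute_out_of_isStabiliserString hM hD hw hP
    exact ⟨w, ⟨hw, fun i => hin i (Set.notMem_empty i)⟩, hout⟩
  · rintro ⟨w, hw, rfl⟩
    exact D.isStabiliserString_out hD hw

theorem forall_isStabiliserString_commute_iff_exists_pauliWeb (hM : M ≠ 0) (hD : D.Represents M)
    {P : PauliString n} :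
    (∀ Q, IsStabiliserString M Q → Commute (pauliMatrix P) (pauliMatrix Q)) ↔
      ∃ w ∈ D.pauliWebs, D.out w = P := by
  constructor
  · intro hP
    obtain ⟨w, hw, -, hout⟩ := D.exists_isPauliWeb_out_eq Set.univ (P := P) fun w hw hin =>
      (hP _ (D.isStabiliserString_out hD ⟨hw, fun i => hin i (Set.mem_univ i)⟩)).symm
    exact ⟨w, hw, hout⟩
  · rintro ⟨w, hw, rfl⟩ Q hQ
    exact D.commute_out_of_isStabiliserString hM hD hw hQ

end ZXDiagram

/-! ### The bijections -/

theorem exists_bijective_quotientClasses {α β : Type*} {G N : Set (Set α)}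
    (h : ∀ g ∈ G, ∀ n ∈ N, g ∆ n ∈ G) {f : G → β} (hf : Function.Surjective f)
    (hfN : ∀ g g' : G, f g = f g' ↔ g.1 ∆ g'.1 ∈ N) :
    ∃ b : quotientClasses G N h → β, Function.Bijective b ∧
      ∀ A, ∀ w ∈ A.1, ∃ hw : w ∈ G, b A = f ⟨w, hw⟩ := by
  have mem_class (g : G) (w : Set α) : (∃ n ∈ N, w = g.1 ∆ n) ↔ ∃ hw : w ∈ G, f g = f ⟨w, hw⟩ := by
    constructor
    · rintro ⟨n, hn, rfl⟩
      exact ⟨h _ g.2 _ hn, (hfN _ _).mpr (by rwa [symmDiff_symmDiff_cancel_left])⟩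
    · rintro ⟨hw, hgw⟩
      exact ⟨_, (hfN _ _).mp hgw, (symmDiff_symmDiff_cancel_left _ _).symm⟩
  choose g hg hclass using fun A : quotientClasses G N h => A.2
  have hmem (A : quotientClasses G N h) (w : Set α) :
      w ∈ A.1 ↔ ∃ hw : w ∈ G, f ⟨g A, hg A⟩ = f ⟨w, hw⟩ := by
    rw [← mem_class, hclass A, Set.mem_ofPred_eq]
  refine ⟨fun A => f ⟨g A, hg A⟩, ⟨fun A A' hA => ?_, fun x => ?_⟩, fun A w hw => (hmem A w).mp hw⟩
  · refine Subtype.ext (Set.ext fun w => ?_)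
    rw [hmem, hmem]
    exact exists_congr fun _ => by rw [show f ⟨g A, hg A⟩ = f ⟨g A', hg A'⟩ from hA]
  · obtain ⟨w, rfl⟩ := hf x
    let A : quotientClasses G N h := ⟨_, w, w.2, rfl⟩
    have hwA : w.1 ∈ A.1 := (mem_class w w).mpr ⟨w.2, rfl⟩
    obtain ⟨_, hAw⟩ := (hmem A w).mp hwA
    exact ⟨A, hAw⟩

namespace ZXDiagram

section SymmDiff

variable {V E : Type*} [Fintype V] [Fintype E] {m n : ℕ} (D : ZXDiagram V E m n)

theorem symmDiff_mem_detectingRegions_iff {w w' : Set (E × Colour)} (hw : w ∈ D.stabilisingWebs)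
    (hw' : w' ∈ D.stabilisingWebs) : w ∆ w' ∈ D.detectingRegions ↔ D.out w = D.out w' := by
  have hstab : D.IsPauliWeb (w ∆ w') ∧ ∀ i, D.Avoids (w ∆ w') (D.input i) :=
    ⟨IsPauliWeb.symmDiff D hw.1 hw'.1, fun i => Avoids.symmDiff D (hw.2 i) (hw'.2 i)⟩
  calc w ∆ w' ∈ D.detectingRegions ↔ ∀ j, D.Avoids (w ∆ w') (D.output j) :=
        ⟨fun h => h.2.2, fun h => ⟨hstab.1, hstab.2, h⟩⟩
    _ ↔ D.out w * D.out w' = 1 := by rw [D.forall_avoids_output_iff, D.out_symmDiff]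
    _ ↔ D.out w = D.out w' := mul_eq_one_iff_eq_inv

theorem mem_trivialWebs_iff {w : Set (E × Colour)} (hw : D.IsPauliWeb w) :
    w ∈ D.trivialWebs ↔ ∃ s ∈ D.stabilisingWebs, D.out s = D.out w := by
  constructor
  · rintro ⟨s, hs, c, hc, rfl⟩
    exact ⟨s, hs, by rw [D.out_symmDiff, (D.forall_avoids_output_iff).mp hc.2, mul_one]⟩
  · rintro ⟨s, hs, hout⟩
    refine ⟨s, hs, s ∆ w, ⟨IsPauliWeb.symmDiff D hs.1 hw, ?_⟩,
      (symmDiff_symmDiff_cancel_left _ _).symm⟩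
    rw [D.forall_avoids_output_iff, D.out_symmDiff, hout]
    exact mul_inv_cancel (D.out w)

end SymmDiff

section Square

variable {V E : Type*} [Fintype V] [Fintype E] {n : ℕ} (D : ZXDiagram V E n n)
  {M : Matrix (Fin n → Fin 2) (Fin n → Fin 2) ℂ}

theorem exists_bijective_stabiliserGroup (hM : M ≠ 0) (hD : D.Represents M) :
    ∃ b : quotientClasses D.stabilisingWebs D.detectingRegions D.stabilisingWebs_symmDiff →
        stabiliserGroup M,
      Function.Bijective b ∧ ∀ A, ∀ w ∈ A.1, IsSignedPauli (b A : QubitUnitary n) (D.out w) := by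
  choose s hs hsw using fun w : D.stabilisingWebs =>
    (D.isStabiliserString_out hD w.2).exists_mem_stabiliserGroup hM
  let f (w : D.stabilisingWebs) : stabiliserGroup M := ⟨s w, hs w⟩
  have hf : Function.Surjective f := by
    rintro ⟨u, hu⟩
    obtain ⟨P, hP, huP⟩ := exists_isStabiliserString_of_mem hM hu
    obtain ⟨w, hw, rfl⟩ := (D.isStabiliserString_iff_exists_stabilisingWeb hM hD).mp hP
    exact ⟨⟨w, hw⟩, Subtype.ext ((hsw ⟨w, hw⟩).eq_of_mem_stabiliserGroup hM (hs _) hu huP)⟩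
  have hf_eq (w w' : D.stabilisingWebs) : f w = f w' ↔ w.1 ∆ w'.1 ∈ D.detectingRegions := by
    rw [D.symmDiff_mem_detectingRegions_iff w.2 w'.2, Subtype.mk.injEq]
    exact ⟨fun h => (hsw w).string_unique (h ▸ hsw w'),
      fun h => (hsw w).eq_of_mem_stabiliserGroup hM (hs w) (hs w') (h ▸ hsw w')⟩
  obtain ⟨b, hb, hbf⟩ := exists_bijective_quotientClasses D.stabilisingWebs_symmDiff hf hf_eq
  refine ⟨b, hb, fun A w hwA => ?_⟩
  obtain ⟨hw, hbA⟩ := hbf A w hwA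
  rw [hbA]
  exact hsw ⟨w, hw⟩

theorem exists_bijective_logicals (hM : M ≠ 0) (hD : D.Represents M) :
    ∃ b : quotientClasses D.pauliWebs D.trivialWebs D.pauliWebs_symmDiff →
        Logicals (stabiliserGroup M),
      Function.Bijective b ∧
      ∀ A, ∀ w ∈ A.1, ∃ h : pauliUnitary (D.out w) ∈ pauliNormalizer (stabiliserGroup M),
        b A = QuotientGroup.mk ⟨pauliUnitary (D.out w), h⟩ := by
  have mem_iff (P : PauliString n) : pauliUnitary P ∈ pauliNormalizer (stabiliserGroup M) ↔
      ∃ w ∈ D.pauliWebs, D.out w = P := by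
    rw [pauliUnitary_mem_pauliNormalizer_iff hM,
      D.forall_isStabiliserString_commute_iff_exists_pauliWeb hM hD]
  have hnorm (w : D.pauliWebs) : pauliUnitary (D.out w) ∈ pauliNormalizer (stabiliserGroup M) :=
    (mem_iff _).mpr ⟨w, w.2, rfl⟩
  let f (w : D.pauliWebs) : Logicals (stabiliserGroup M) :=
    QuotientGroup.mk ⟨pauliUnitary (D.out w), hnorm w⟩
  have hf : Function.Surjective f := by
    intro x
    obtain ⟨P, hP, rfl⟩ := exists_eq_mk_pauliUnitary x
    obtain ⟨w, hw, rfl⟩ := (mem_iff _).mp hP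
    exact ⟨⟨w, hw⟩, rfl⟩
  have hf_eq (w w' : D.pauliWebs) : f w = f w' ↔ w.1 ∆ w'.1 ∈ D.trivialWebs := by
    rw [QuotientGroup.eq, Subgroup.mem_subgroupOf,
      D.mem_trivialWebs_iff (IsPauliWeb.symmDiff D w.2 w'.2), D.out_symmDiff,
      ← D.isStabiliserString_iff_exists_stabilisingWeb hM hD]
    exact pauliUnitary_inv_mul_mem_sup_iff hM
  obtain ⟨b, hb, hbf⟩ := exists_bijective_quotientClasses D.pauliWebs_symmDiff hf hf_eq
  exact ⟨b, hb, fun A w hwA => (hbf A w hwA).imp' (fun hw => hnorm ⟨w, hw⟩) fun _ h => h⟩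

end Square

end ZXDiagram

end FloquetWebs

end

theorem mainTheorem11_general {V E : Type*} [Fintype V] [Fintype E] {n : ℕ}
    {M : Matrix (Fin n → Fin 2) (Fin n → Fin 2) ℂ} (hM : M ≠ 0)
    (D : ZXDiagram V E n n) (hD : D.Represents M) :
    (∃ b : quotientClasses D.stabilisingWebs D.detectingRegions D.stabilisingWebs_symmDiff →
          stabiliserGroup M,
        Function.Bijective b ∧
        ∀ A, ∀ w ∈ A.1,
          ((b A : QubitUnitary n) : Matrix (Fin n → Fin 2) (Fin n → Fin 2) ℂ) =
              pauliMatrix (D.out w) ∨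
          ((b A : QubitUnitary n) : Matrix (Fin n → Fin 2) (Fin n → Fin 2) ℂ) =
              -pauliMatrix (D.out w)) ∧
    (∃ b : quotientClasses D.pauliWebs D.trivialWebs D.pauliWebs_symmDiff →
          Logicals (stabiliserGroup M),
        Function.Bijective b ∧
        ∀ A, ∀ w ∈ A.1,
          ∃ h : pauliUnitary (D.out w) ∈ pauliNormalizer (stabiliserGroup M),
            b A = QuotientGroup.mk ⟨pauliUnitary (D.out w), h⟩) :=
  ⟨D.exists_bijective_stabiliserGroup hM hD, D.exists_bijective_logicals hM hD⟩

theorem mainTheorem11 {V E : Type*} [Fintype V] [Fintype E] {n : ℕ}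
    (F : FloquetCode n) (o : ℕ → Bool) (t : ℕ) (hC : F.circuit o t ≠ 0)
    (D : ZXDiagram V E n n) (hD : D.Represents (F.circuit o t)) :
    (∃ b : quotientClasses D.stabilisingWebs D.detectingRegions D.stabilisingWebs_symmDiff →
          F.instStabGroup o t,
        Function.Bijective b ∧
        ∀ A, ∀ w ∈ A.1,
          ((b A : QubitUnitary n) : Matrix (Fin n → Fin 2) (Fin n → Fin 2) ℂ) =
              pauliMatrix (D.out w) ∨
          ((b A : QubitUnitary n) : Matrix (Fin n → Fin 2) (Fin n → Fin 2) ℂ) =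
              -pauliMatrix (D.out w)) ∧
    (∃ b : quotientClasses D.pauliWebs D.trivialWebs D.pauliWebs_symmDiff →
          Logicals (F.instStabGroup o t),
        Function.Bijective b ∧
        ∀ A, ∀ w ∈ A.1,
          ∃ h : pauliUnitary (D.out w) ∈ pauliNormalizer (F.instStabGroup o t),
            b A = QuotientGroup.mk ⟨pauliUnitary (D.out w), h⟩) :=
  mainTheorem11_general hC D hD
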